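/- **Setting.** Let $S$ be a complete separable metric space with Borel $\sigma$-algebra and a $\sigma$-finite Borel reference measure $|\cdot|$, with integration written $\mathrm{d}u$. Let $\mathcal X_S$ be the set of locally finite configurations in $S$ (subsets of $S$ with finitely many points in each bounded set), with the $\sigma$-algebra generated by the counts $\mathbf x\mapsto\#(\mathbf x\cap A)$, $A\subseteq S$ Borel. A point process on $S$ is a random element of $\mathcal X_S$. The space $S\times\{0,1\}$ is treated in the same way, with reference measure the product of $|\cdot|$ and counting measure, and bounded sets those with bounded projection to $S$. For a configuration $\mathbf x$, $\sum^{\neq}_{x_1,\dots,x_n\in\mathbf x}$ denotes the sum over all $n$-tuples of pairwise distinct points of $\mathbf x$. An $n$th-order product density of a point process $X$ is a measurable $\rho_X^{(n)}:S^n\to[0,\infty]$ such that $$\mathbb E\Big[\sum\nolimits^{\neq}_{x_1,\dots,x_n\in X}h(x_1,\dots,x_n)\Big]=\int_{S^n}h(u)\,\rho_X^{(n)}(u)\,\mathrm{d}u_1\cdots\mathrm{d}u_n$$ for all measurable $h\ge0$. An $n$th-order Papangelou conditional intensity of $X$ is a measurable $\lambda_X^{(n)}:S^n\times\mathcal X_S\to[0,\infty]$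 such that $$\mathbb E\Big[\sum\nolimits^{\neq}_{x_1,\dots,x_n\in X}h(x_1,\dots,x_n,X\setminus\{x_1,\dots,x_n\})\Big]=\int_{S^n}\mathbb E\big[h(u,X)\,\lambda_X^{(n)}(u;X)\big]\mathrm{d}u_1\cdots\mathrm{d}u_n$$ for all measurable $h\ge 0$. Let $p:S\to(0,1)$ be measurable. An independent thinning $Z$ of $X$ with retention probability function $p$ is given by a marked point process $\breve X=\{(x,m(x)):x\in X\}$ on $S\times\{0,1\}$ such that, conditionally on $X$, the marks are independent with $m(x)=1$ with probability $p(x)$ and $m(x)=0$ otherwise, and by $Z=\{x:(x,1)\in\breve X\}$. **Theorem.** Let $Z$ be an independent thinning of a point process $X$ on $S$ with retention probability function $p(u)\in(0,1)$, $u\in S$, let $\breve X$ be the associated marked point process, let $Y=X\setminus Z$, and let $n\ge1$. 1. For every measurable $h:S^n\times\mathcal X_S\to[0,\infty]$, $$\mathbb E\Big[\sum\nolimits^{\neq}_{x_1,\dots,x_n\in Z}h(x_1,\dots,x_n,Y)\prod_{i=1}^n(1-p(x_i))\Big]=\mathbb E\Big[\sum\nolimits^{\neq}_{x_1,\dots,x_n\in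 Y}h(x_1,\dots,x_n,Y\setminus\{x_1,\dots,x_n\})\prod_{i=1}^np(x_i)\Big].$$ The same identity holds for every measurable $h:S^n\times\mathcal X_S\to\mathbb R$ for which one of the two sides is finite when $h$ is replaced by $|h|$; both sums then converge absolutely almost surely and have integrable values. 2. If $\lambda_X^{(n)}$ and $\lambda_Z^{(n)}$ are $n$th-order Papangelou conditional intensities of $X$ and $Z$, then for almost all $(u_1,\dots,u_n)\in S^n$, almost surely, $$\lambda_Z^{(n)}(u_1,\dots,u_n;Z)=p(u_1)\cdots p(u_n)\,\mathbb E\big[\lambda_X^{(n)}(u_1,\dots,u_n;X)\,\big|\,Z\big].$$ 3. If $\rho_X^{(n)}$ and $\rho_Z^{(n)}$ are $n$th-order product densities of $X$ and $Z$, then for almost all $(u_1,\dots,u_n)\in S^n$, $$\rho_Z^{(n)}(u_1,\dots,u_n)=p(u_1)\cdots p(u_n)\,\rho_X^{(n)}(u_1,\dots,u_n).$$ 4. If $\breve\lambda^{(n)}$ and $\lambda_Y^{(n)}$ are $n$th-order Papangelou conditional intensities of $\breve X$ and $Y$, then for almost all $(u_1,\dots,u_n)\in S^n$, almost surely, $$\mathbb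 E\big[\breve\lambda^{(n)}((u_1,1),\dots,(u_n,1);\breve X)\,\big|\,Y\big]=\frac{\prod_{i=1}^np(u_i)}{\prod_{i=1}^n(1-p(u_i))}\,\lambda_Y^{(n)}(u_1,\dots,u_n;Y).$$ In particular all this holds when $p(\cdot)\equiv p\in(0,1)$ is constant. -/

import Mathlib

open MeasureTheory ProbabilityTheory Set
open scoped ENNReal unitInterval

/-- The mark space `{0, 1}` is bounded, so that all of its subsets are bounded. A subset of
`S × {0, 1}` is then bounded iff its projection to `S` is. -/
instance Fin.bornologyTwo : Bornology (Fin 2) := Bornology.cofinite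

/-- A (simple) locally finite point configuration in `S`: a subset of `S` having finitely many
points in every bounded set. -/
@[ext]
structure PointConfig (S : Type*) [Bornology S] where
  /-- the set of points -/
  carrier : Set S
  finite_inter : ∀ A : Set S, Bornology.IsBounded A → (carrier ∩ A).Finite

namespace PointConfig

section

variable {S : Type*} [Bornology S]

instance : Membership S (PointConfig S) := ⟨fun x s => s ∈ x.carrier⟩

/-- The σ-algebra generated by the counting maps `x ↦ #(x ∩ A)`, `A ⊆ S` measurable. -/
noncomputable instance [MeasurableSpace S] : MeasurableSpace (PointConfig S) :=
  ⨆ (A : Set S) (_ : MeasurableSet A),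
    MeasurableSpace.comap (fun x : PointConfig S => (x.carrier ∩ A).encard) inferInstance

/-- The configuration of the points of `x` that are not in the set `B`. -/
def remove (x : PointConfig S) (B : Set S) : PointConfig S where
  carrier := x.carrier \ B
  finite_inter A hA := (x.finite_inter A hA).subset (inter_subset_inter_left A sdiff_subset)

/-- The configuration `x ∖ y`. -/
instance : SDiff (PointConfig S) := ⟨fun x y => x.remove y.carrier⟩

/-- The `n`-tuples of pairwise distinct points of `x`. -/
def distinctTuples (x : PointConfig S) (n : ℕ) : Set (Fin n → S) :=
  {u | Function.Injective u ∧ ∀ i, u i ∈ x}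

/-- The marked configuration `{(s, m s) : s ∈ x}`, for a marking function `m`. -/
def mark (x : PointConfig S) (m : S → Fin 2) : PointConfig (S × Fin 2) where
  carrier := (fun s => (s, m s)) '' x.carrier
  finite_inter A hA := by
    refine ((x.finite_inter _ hA.image_fst).image fun s => (s, m s)).subset ?_
    rintro _ ⟨⟨s, hs, rfl⟩, hA'⟩
    exact ⟨s, ⟨hs, ⟨_, hA', rfl⟩⟩, rfl⟩

/-- The configuration `{s : (s, i) ∈ y}` of the points with mark `i`. -/
def withMark (y : PointConfig (S × Fin 2)) (i : Fin 2) : PointConfig S where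
  carrier := {s | (s, i) ∈ y}
  finite_inter A hA := by
    have hB : Bornology.IsBounded (A ×ˢ (univ : Set (Fin 2))) :=
      hA.prod (Bornology.isBounded_def.2 (by
        change _ ∈ Filter.cofinite
        exact Filter.mem_cofinite.2 (Set.toFinite _)))
    refine ((y.finite_inter _ hB).image Prod.fst).subset ?_
    rintro s ⟨hs, hA'⟩
    exact ⟨(s, i), ⟨hs, hA', mem_univ _⟩, rfl⟩

end

end PointConfig

section

variable {S Ω : Type*} [Bornology S] [MeasurableSpace S] [MeasurableSpace Ω]

/-- The law of a field of independent marks `m s`, `s ∈ S`, with `m s = 1` with probability `p s`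
and `m s = 0` with probability `1 - p s`. -/
noncomputable def indepMarkLaw (p : S → I) : Measure (S → Fin 2) :=
  Measure.infinitePi fun s => bernoulliMeasure (1 : Fin 2) 0 (p s)

/-- `Z` is an independent thinning of the point process `X` with retention probability function
`p`, where `Xb` is the associated bivariate marking of `X`: conditionally on `X`, the points `s` of
`X` receive independent marks, equal to `1` with probability `p s` and to `0` otherwise, and `Z`
consists of the points with mark `1`. -/
structure IsIndepThinning (P : Measure Ω) (p : S → I) (X : Ω → PointConfig S)
    (Xb : Ω → PointConfig (S × Fin 2)) (Z : Ω → PointConfig S) : Prop where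
  measurable_ground : Measurable X
  measurable_marked : Measurable Xb
  exists_marks : ∀ ω, ∃ m : S → Fin 2, Xb ω = (X ω).mark m
  cond_law : ∀ E : Set (PointConfig (S × Fin 2)), MeasurableSet E →
    P⟦Xb ⁻¹' E | MeasurableSpace.comap X inferInstance⟧ =ᵐ[P]
      fun ω => (indepMarkLaw p).real {m | (X ω).mark m ∈ E}
  retained : ∀ ω, Z ω = (Xb ω).withMark 1

/-- `ρ` is an `n`th-order product density of the point process `X`, with respect to the reference
measure `μ`, i.e. the Campbell formula holds for all non-negative `h`. -/
def IsProductDensity (P : Measure Ω) (μ : Measure S) (X : Ω → PointConfig S) (n : ℕ)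
    (ρ : (Fin n → S) → ℝ≥0∞) : Prop :=
  Measurable ρ ∧
    ∀ h : (Fin n → S) → ℝ≥0∞, Measurable h →
      ∫⁻ ω, ∑' x : (X ω).distinctTuples n, h x ∂P =
        ∫⁻ u, h u * ρ u ∂(Measure.pi fun _ : Fin n => μ)

/-- `lam` is an `n`th-order Papangelou conditional intensity of the point process `X`, with
respect to the reference measure `μ`, i.e. the Georgii-Nguyen-Zessin formula holds for all
non-negative `h`. -/
def IsPapangelou (P : Measure Ω) (μ : Measure S) (X : Ω → PointConfig S) (n : ℕ)
    (lam : (Fin n → S) → PointConfig S → ℝ≥0∞) : Prop :=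
  Measurable (Function.uncurry lam) ∧
    ∀ h : (Fin n → S) → PointConfig S → ℝ≥0∞, Measurable (Function.uncurry h) →
      ∫⁻ ω, ∑' x : (X ω).distinctTuples n, h x ((X ω).remove (range x.1)) ∂P =
        ∫⁻ u, ∫⁻ ω, h u (X ω) * lam u (X ω) ∂P ∂(Measure.pi fun _ : Fin n => μ)

end

/-!
Given `X`, the marks of a tuple `u` of distinct points of `X` are independent of the marks of the
other points, which form an independent marking of `X \ u`. Hence the expected sum of
`h(u, (X \ u)_d)` over the tuples with all marks equal to `c`, where the index `d` selects the
points with mark `d`, is the expected sum over all tuples `u` of `X` of the probability of the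
marks of `u` times the mean of `h(u, ·)` under the law of the points with mark `d` in a marking of `X \ u`
(`IsIndepThinning.lintegral_tsum_withMark`, from `PointConfig.lintegral_indicator_mul_mark`).

* With the weights `1 - p` for `Z` and `p` for `Y`, the probabilities of the marks become
  `∏ p(uᵢ) (1 - p(uᵢ))` in both cases, which is the thinning formula.
* For `c = d = 1` the mean under the marking is a function of `u` and `X \ u`, so the
  Georgii-Nguyen-Zessin formula of `X` gives
  `E ∑_{u ⊆ Z} h(u, Z \ u) = ∫ ∏ p(uᵢ) E[h(u, Z) lamX(u; X)] du`. Compared with the formula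
  of `Z`, this identifies the conditional intensity of `Z`. The product densities are the case of a
  function `h` that does not depend on the configuration.
* The formula of the marked process on tuples with all marks `1` and functions of `Y` gives
  `E ∑_{u ⊆ Z} h(u, Y)`, which the thinning formula turns into a sum over tuples of `Y`.

Two measurability questions have to be settled. The law of the marking of `x` is a measurable
function of `x` (`PointConfig.markKernel`): the events of having no point in a given set form a
`π`-system generating the `σ`-algebra of configurations (`PointConfig.generateFrom_void`), and their
probabilities are limits of finite products. Moreover, an identity of integrals over `u` yields, for
almost all `u`, an identity of conditional expectations, because a jointly measurable function has
conditional expectations that are jointly measurable in `u` and the conditioning variable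
(`ae_condLExp_eq_of_lintegral_eq`).
-/

/-! ### Measurability of maps into and out of the space of configurations -/

namespace PointConfig

section Basic

variable {S β : Type*} [Bornology S] [MeasurableSpace S] [MeasurableSpace β]

lemma mem_iff {S : Type*} [Bornology S] {x : PointConfig S} {s : S} :
    s ∈ x ↔ s ∈ x.carrier := Iff.rfl

lemma measurable_encard {A : Set S} (hA : MeasurableSet A) :
    Measurable fun x : PointConfig S => (x.carrier ∩ A).encard := by
  intro t ht
  exact (le_iSup₂ (f := fun (A : Set S) (_ : MeasurableSet A) =>
    MeasurableSpace.comap (fun x : PointConfig S => (x.carrier ∩ A).encard) inferInstance) A hA) _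
    ⟨t, ht, rfl⟩

lemma measurable_of_encard {f : β → PointConfig S}
    (hf : ∀ A : Set S, MeasurableSet A → Measurable fun b => ((f b).carrier ∩ A).encard) :
    Measurable f := by
  rw [measurable_iff_comap_le]
  change MeasurableSpace.comap f (⨆ (A : Set S) (_ : MeasurableSet A),
    MeasurableSpace.comap (fun x : PointConfig S => (x.carrier ∩ A).encard) inferInstance) ≤ _
  simp only [MeasurableSpace.comap_iSup, iSup_le_iff, MeasurableSpace.comap_comp]
  exact fun A hA => (hf A hA).comap_le

lemma measurable_of_encard_toENNReal {f : β → PointConfig S}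
    (hf : ∀ A : Set S, MeasurableSet A →
      Measurable fun b => (((f b).carrier ∩ A).encard : ℝ≥0∞)) :
    Measurable f := by
  refine measurable_of_encard fun A hA => ENat.measurable_iff.2 fun n => ?_
  convert! hf A hA (measurableSet_singleton (n : ℝ≥0∞)) using 1
  ext b
  simp only [mem_preimage, mem_singleton_iff]
  norm_cast

/-- The set of configurations without points in `A`. -/
def void (A : Set S) : Set (PointConfig S) := {x | x.carrier ∩ A = ∅}

lemma measurableSet_void {A : Set S} (hA : MeasurableSet A) :
    MeasurableSet (void A : Set (PointConfig S)) := by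
  convert! measurable_encard hA (measurableSet_singleton 0) using 1
  ext x
  simp [void]

lemma isPiSystem_void :
    IsPiSystem {V : Set (PointConfig S) | ∃ A, MeasurableSet A ∧ V = void A} := by
  rintro _ ⟨A, hA, rfl⟩ _ ⟨B, hB, rfl⟩ -
  refine ⟨A ∪ B, hA.union hB, ?_⟩
  ext x
  simp [void, inter_union_distrib_left]

/-- A configuration has at least `k` points in `A` iff it has a point in each of `k` pairwise
disjoint pieces of `A` cut out by basic open sets. Hence the events that there is no point in a
given set generate the `σ`-algebra. -/
lemma generateFrom_void [TopologicalSpace S] [SecondCountableTopology S] [T2Space S]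
    [OpensMeasurableSpace S] :
    (inferInstance : MeasurableSpace (PointConfig S)) =
      MeasurableSpace.generateFrom {V | ∃ A, MeasurableSet A ∧ V = void A} := by
  refine le_antisymm ?_ ?_
  · set m := MeasurableSpace.generateFrom
      {V : Set (PointConfig S) | ∃ A, MeasurableSet A ∧ V = void A} with hm
    have hv (A : Set S) (hA : MeasurableSet A) : MeasurableSet[m] (void A : Set (PointConfig S)) :=
      MeasurableSpace.measurableSet_generateFrom ⟨A, hA, rfl⟩
    let b := TopologicalSpace.countableBasis S
    have hb := TopologicalSpace.isBasis_countableBasis S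
    have hge (A : Set S) (hA : MeasurableSet A) (k : ℕ) :
        MeasurableSet[m] {x : PointConfig S | (k : ℕ∞) ≤ (x.carrier ∩ A).encard} := by
      have : {x : PointConfig S | (k : ℕ∞) ≤ (x.carrier ∩ A).encard} =
          ⋃ U : {U : Fin k → b // Pairwise fun i j => Disjoint (U i : Set S) (U j : Set S)},
            ⋂ i, (void (A ∩ (U.1 i : Set S)))ᶜ := by
        ext x
        simp only [mem_ofPred_eq, mem_iUnion, mem_iInter]
        constructor
        · intro hx
          obtain ⟨T, hT, hTk⟩ := exists_subset_encard_eq hx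
          have hTf : T.Finite := finite_of_encard_eq_coe hTk
          obtain ⟨V, hV, hVd⟩ := hTf.t2_separation
          have hc : Nat.card T = k := by
            have := hTf.cast_ncard_eq
            rw [hTk] at this
            rw [Nat.card_coe_set_eq]; exact_mod_cast this
          have := hTf.to_subtype
          let e : Fin k ≃ T := (finCongr hc.symm).trans (Finite.equivFin T).symm
          choose W hW hxW hWV using fun i => hb.exists_subset_of_mem_open (hV (e i)).1 (hV (e i)).2
          refine ⟨⟨fun i => ⟨W i, hW i⟩, fun i j hij => ?_⟩, fun i => ?_⟩
          · refine (hVd (e i).2 (e j).2 ?_).mono (hWV i) (hWV j)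
            exact fun h => hij (e.injective (Subtype.ext h))
          · have := hT (e i).2
            exact fun h => notMem_empty _ (h.subset ⟨this.1, this.2, hxW i⟩)
        · rintro ⟨⟨U, hU⟩, h⟩
          have h' : ∀ i, ∃ s, s ∈ x.carrier ∩ (A ∩ (U i : Set S)) := fun i =>
            nonempty_iff_ne_empty.2 (h i)
          choose s hs using h'
          have hinj : Function.Injective s := by
            intro i j hij
            by_contra hne
            exact disjoint_left.1 (hU hne) (hs i).2.2 (hij ▸ (hs j).2.2)
          calc (k : ℕ∞) = (range s).encard := by
                rw [← image_univ, hinj.encard_image, encard_univ]; simp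
            _ ≤ _ := encard_le_encard (by rintro _ ⟨i, rfl⟩; exact ⟨(hs i).1, (hs i).2.1⟩)
      rw [this]
      have : Countable b := (TopologicalSpace.countable_countableBasis S).to_subtype
      refine MeasurableSet.iUnion fun U => MeasurableSet.iInter fun i => (hv _ ?_).compl
      exact hA.inter (hb.isOpen (U.1 i).2).measurableSet
    refine iSup₂_le fun A hA => ?_
    rw [← measurable_iff_comap_le]
    refine ENat.measurable_iff.2 fun n => ?_
    convert! (hge A hA n).diff (hge A hA (n + 1)) using 1
    ext x
    simp only [mem_preimage, mem_singleton_iff, mem_sdiff, mem_ofPred_eq, not_le, Nat.cast_add,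
      Nat.cast_one]
    constructor
    · intro h; rw [h]; exact ⟨le_rfl, by exact_mod_cast n.lt_succ_self⟩
    · rintro ⟨h1, h2⟩; exact le_antisymm (Order.le_of_lt_add_one h2) h1
  · refine MeasurableSpace.generateFrom_le ?_
    rintro _ ⟨A, hA, rfl⟩
    exact measurableSet_void hA

lemma measurable_withMark (i : Fin 2) :
    Measurable fun y : PointConfig (S × Fin 2) => y.withMark i := by
  refine measurable_of_encard fun A hA => ?_
  have : (fun y : PointConfig (S × Fin 2) => ((y.withMark i).carrier ∩ A).encard) =
      fun y => (y.carrier ∩ A ×ˢ {i}).encard := by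
    ext1 y
    rw [← (Prod.mk_left_injective i).encard_image]
    congr 1
    ext ⟨s, j⟩
    simp only [withMark, mem_image, mem_inter_iff, mem_ofPred_eq, Prod.mk.injEq, mem_prod,
      mem_singleton_iff, mem_iff]
    constructor
    · rintro ⟨s, ⟨h1, h2⟩, rfl, rfl⟩; exact ⟨h1, h2, rfl⟩
    · rintro ⟨h1, h2, rfl⟩; exact ⟨s, ⟨h1, h2⟩, rfl, rfl⟩
  rw [this]
  exact measurable_encard (hA.prod (measurableSet_singleton i))

end Basic

end PointConfig

/-! ### Sums over tuples of points of a configuration -/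

namespace PointConfig

section Tuples

universe v

variable {S β : Type v} [PseudoMetricSpace S] [MeasurableSpace S] [MeasurableSpace β]

lemma countable_carrier {S : Type*} [PseudoMetricSpace S] (x : PointConfig S) :
    x.carrier.Countable := by
  rcases isEmpty_or_nonempty S with h | ⟨⟨o⟩⟩
  · exact Set.to_countable _
  · have : x.carrier = ⋃ k : ℕ, x.carrier ∩ Metric.ball o k := by
      rw [← inter_iUnion, Metric.iUnion_ball_nat, inter_univ]
    rw [this]
    exact countable_iUnion fun k => (x.finite_inter _ Metric.isBounded_ball).countable

lemma sum_dirac_apply (x : PointConfig S) {A : Set S} (hA : MeasurableSet A) :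
    (Measure.sum fun s : x.carrier => Measure.dirac (s : S)) A = (x.carrier ∩ A).encard := by
  rw [Measure.sum_apply _ hA, ← ENNReal.tsum_set_one,
    tsum_subtype (x.carrier ∩ A) (fun _ => (1 : ℝ≥0∞)), ← indicator_indicator,
    ← tsum_subtype x.carrier]
  exact tsum_congr fun s => Measure.dirac_apply' _ hA

/-- The kernel assigning to a configuration `x` the counting measure `∑_{s ∈ x} δ_s`. -/
noncomputable def pointKernel (S : Type*) [PseudoMetricSpace S] [MeasurableSpace S] :
    Kernel (PointConfig S) S where
  toFun x := Measure.sum fun s : x.carrier => Measure.dirac (s : S)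
  measurable' := by
    refine Measure.measurable_of_measurable_coe _ fun A hA => ?_
    simp only [sum_dirac_apply _ hA]
    exact measurable_from_top.comp (measurable_encard hA)

lemma pointKernel_apply (x : PointConfig S) {A : Set S} (hA : MeasurableSet A) :
    pointKernel S x A = (x.carrier ∩ A).encard :=
  sum_dirac_apply x hA

lemma lintegral_pointKernel (x : PointConfig S) {f : S → ℝ≥0∞} (hf : Measurable f) :
    ∫⁻ s, f s ∂pointKernel S x = ∑' s : x.carrier, f s := by
  change ∫⁻ s, f s ∂(Measure.sum fun s : x.carrier => Measure.dirac (s : S)) = _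
  rw [lintegral_sum_measure]
  exact tsum_congr fun s => lintegral_dirac' _ hf

variable [OpensMeasurableSpace S]

open Classical in
/-- The kernel `x ↦ ∑_{s ∈ x} δ_s` is not uniformly bounded on bounded sets, so it is decomposed
according to the number of points in each of countably many bounded pieces of the space. -/
instance : IsSFiniteKernel (pointKernel S) := by
  rcases isEmpty_or_nonempty S with h | ⟨⟨o⟩⟩
  · have : pointKernel S = 0 := by
      ext x A
      rw [Set.eq_empty_of_isEmpty A]; simp
    rw [this]; infer_instance
  let D : ℕ → Set S := disjointed fun k : ℕ => Metric.ball o k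
  have hDm (k) : MeasurableSet (D k) :=
    MeasurableSet.disjointed (fun k => Metric.isOpen_ball.measurableSet) k
  have hDf (x : PointConfig S) (k) : (x.carrier ∩ D k).Finite :=
    x.finite_inter _ (Metric.isBounded_ball.subset (disjointed_subset _ k))
  have hDU : ⋃ k, D k = univ := by
    rw [iUnion_disjointed, Metric.iUnion_ball_nat]
  have hDd : Pairwise (Function.onFun Disjoint D) := disjoint_disjointed _
  have hNm (k m : ℕ) : MeasurableSet {x : PointConfig S | (x.carrier ∩ D k).encard = m} :=
    measurable_encard (hDm k) (measurableSet_singleton (m : ℕ∞))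
  let κ (i : ℕ × ℕ) : Kernel (PointConfig S) S :=
    Kernel.piecewise (hNm i.1 i.2) ((pointKernel S).restrict (hDm i.1)) 0
  have hκ (i) : IsFiniteKernel (κ i) := by
    refine ⟨i.2, ENNReal.natCast_lt_top _, fun x => ?_⟩
    rw [Kernel.piecewise_apply]
    split_ifs with hx
    · rw [Kernel.restrict_apply, Measure.restrict_apply .univ, univ_inter,
        pointKernel_apply _ (hDm _), show _ = _ from hx]
      simp
    · simp
  have : pointKernel S = Kernel.sum κ := by
    ext x A hA
    rw [Kernel.sum_apply' _ _ hA, ENNReal.tsum_prod (f := fun k m => κ (k, m) x A)]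
    have h1 (k : ℕ) : ∑' m, κ (k, m) x A = pointKernel S x (A ∩ D k) := by
      rw [tsum_eq_single (x.carrier ∩ D k).ncard]
      · rw [Kernel.piecewise_apply, if_pos, Kernel.restrict_apply, Measure.restrict_apply hA]
        exact ((hDf x k).cast_ncard_eq).symm
      · intro m hm
        rw [Kernel.piecewise_apply, if_neg]
        · simp
        · intro h
          refine hm ?_
          rw [mem_ofPred_eq, ← (hDf x k).cast_ncard_eq] at h
          exact_mod_cast h.symm
    simp only [h1]
    rw [← measure_iUnion _ fun k => hA.inter (hDm k), ← inter_iUnion, hDU, inter_univ]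
    exact fun i j hij => (hDd hij).mono inter_subset_right inter_subset_right
  rw [this]
  infer_instance

lemma measurable_tsum_points {c : β → PointConfig S} (hc : Measurable c) {f : S → β → ℝ≥0∞}
    (hf : Measurable (Function.uncurry f)) :
    Measurable fun b => ∑' s : (c b).carrier, f s b := by
  have : (fun b => ∑' s : (c b).carrier, f s b) =
      fun b => ∫⁻ s, f s b ∂((pointKernel S).comap c hc) b := by
    ext1 b
    rw [Kernel.comap_apply, lintegral_pointKernel _ (f := fun s => f s b) (by fun_prop)]
  rw [this]
  exact Measurable.lintegral_kernel_prod_right (f := fun b s => f s b) (by fun_prop)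

/-- A point is added to the tuple in each step of an induction on `n`, the other points being
treated as parameters. -/
lemma measurable_tsum_tuples (n : ℕ) : ∀ {β : Type v} [MeasurableSpace β] {c : β → PointConfig S}
    (_ : Measurable c) {f : (Fin n → S) → β → ℝ≥0∞} (_ : Measurable (Function.uncurry f)),
    Measurable fun b => ∑' u : {u : Fin n → S | ∀ i, u i ∈ c b}, f u b := by
  induction n with
  | zero =>
    intro β _ c hc f hf
    have : (fun b => ∑' u : {u : Fin 0 → S | ∀ i, u i ∈ c b}, f u b) =
        fun b => f Fin.elim0 b := by
      ext1 b
      rw [tsum_subtype {u : Fin 0 → S | ∀ i, u i ∈ c b} (fun u => f u b), tsum_fintype]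
      simp [Subsingleton.elim _ (Fin.elim0 : Fin 0 → S)]
    rw [this]
    exact hf.of_uncurry_left
  | succ n ih =>
    intro β _ c hc f hf
    have key : (fun b => ∑' u : {u : Fin (n + 1) → S | ∀ i, u i ∈ c b}, f u b) =
        fun b => ∑' s : (c b).carrier, ∑' v : {v : Fin n → S | ∀ i, v i ∈ c b},
          f (Fin.cons (s : S) (v : Fin n → S)) b := by
      ext1 b
      rw [← ENNReal.tsum_prod (f := fun (s : (c b).carrier)
        (v : {v : Fin n → S | ∀ i, v i ∈ c b}) => f (Fin.cons (s : S) (v : Fin n → S)) b)]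
      let e : (c b).carrier × {v : Fin n → S | ∀ i, v i ∈ c b} ≃
          {u : Fin (n + 1) → S | ∀ i, u i ∈ c b} :=
        { toFun := fun q => ⟨Fin.cons (q.1 : S) (q.2 : Fin n → S), fun i => by
            refine Fin.cases ?_ (fun j => ?_) i
            · exact q.1.2
            · exact q.2.2 j⟩
          invFun := fun u => (⟨u.1 0, u.2 0⟩, ⟨fun j => u.1 j.succ, fun j => u.2 j.succ⟩)
          left_inv := fun q => by simp
          right_inv := fun u => by
            ext i
            refine Fin.cases ?_ (fun j => ?_) i <;> simp }
      exact (e.tsum_eq fun u => f u b).symm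
    rw [key]
    refine measurable_tsum_points hc (f := fun s b => ∑' v : {v : Fin n → S | ∀ i, v i ∈ c b},
          f (Fin.cons s (v : Fin n → S)) b) ?_
    refine ih (β := S × β) (c := fun q => c q.2) (hc.comp measurable_snd)
      (f := fun v q => f (Fin.cons q.1 v) q.2) ?_
    refine hf.comp (Measurable.prodMk ?_ (by fun_prop))
    refine measurable_pi_lambda _ fun i => ?_
    refine Fin.cases ?_ (fun j => ?_) i
    · exact (measurable_fst.comp measurable_snd :
        Measurable fun q : (Fin n → S) × (S × β) => q.2.1)
    · exact ((measurable_pi_apply j).comp measurable_fst :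
        Measurable fun q : (Fin n → S) × (S × β) => q.1 j)

lemma measurableSet_injective {S : Type*} [MeasurableSpace S] [MeasurableEq S] (n : ℕ) :
    MeasurableSet {u : Fin n → S | Function.Injective u} := by
  have : {u : Fin n → S | Function.Injective u} =
      ⋂ (i) (j) (_ : i ≠ j), {u : Fin n → S | u i = u j}ᶜ := by
    ext u
    simp only [mem_ofPred_eq, mem_iInter, mem_compl_iff]
    exact ⟨fun h i j hij e => hij (h e), fun h i j e => by_contra fun hij => h i j hij e⟩
  rw [this]
  exact .iInter fun i => .iInter fun j => .iInter fun _ =>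
    (measurableSet_eq_fun (measurable_pi_apply i) (measurable_pi_apply j)).compl

lemma tsum_distinctTuples {S : Type*} [Bornology S] (x : PointConfig S) (n : ℕ)
    (f : (Fin n → S) → ℝ≥0∞) :
    ∑' u : x.distinctTuples n, f u =
      ∑' u : {u : Fin n → S | ∀ i, u i ∈ x}, {u | Function.Injective u}.indicator f u := by
  rw [tsum_subtype (x.distinctTuples n), tsum_subtype {u : Fin n → S | ∀ i, u i ∈ x},
    indicator_indicator]
  congr! 3
  ext u
  simp [distinctTuples, and_comm]

lemma countable_distinctTuples {S : Type*} [PseudoMetricSpace S] (x : PointConfig S) (n : ℕ) :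
    (x.distinctTuples n).Countable := by
  refine (countable_pi fun _ : Fin n => x.countable_carrier).mono ?_
  exact fun u hu i => hu.2 i

variable [MeasurableEq S]

lemma measurable_tsum_distinctTuples {c : β → PointConfig S} (hc : Measurable c) {n : ℕ}
    {f : (Fin n → S) → β → ℝ≥0∞} (hf : Measurable (Function.uncurry f)) :
    Measurable fun b => ∑' u : (c b).distinctTuples n, f u b := by
  simp only [fun b => tsum_distinctTuples (c b) n fun u => f u b]
  refine measurable_tsum_tuples n hc
    (f := fun u b => {u | Function.Injective u}.indicator (fun u => f u b) u) ?_
  exact hf.indicator (measurable_fst (measurableSet_injective n))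

lemma measurable_remove_range {n : ℕ} :
    Measurable fun q : (Fin n → S) × PointConfig S => q.2.remove (range q.1) := by
  refine measurable_of_encard_toENNReal fun A hA => ?_
  have hm : MeasurableSet {r : S × ((Fin n → S) × PointConfig S) |
      r.1 ∈ A ∧ r.1 ∉ range r.2.1} := by
    refine (measurable_fst hA).inter (MeasurableSet.compl ?_)
    have : {r : S × ((Fin n → S) × PointConfig S) | r.1 ∈ range r.2.1} =
        ⋃ i, {r | r.2.1 i = r.1} := by
      ext r; simp
    change MeasurableSet {r : S × ((Fin n → S) × PointConfig S) | r.1 ∈ range r.2.1}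
    rw [this]
    exact .iUnion fun i => measurableSet_eq_fun (by fun_prop) (by fun_prop)
  have := measurable_tsum_points (S := S) (c := fun q : (Fin n → S) × PointConfig S => q.2)
    measurable_snd (f := fun s q => {r : S × ((Fin n → S) × PointConfig S) |
      r.1 ∈ A ∧ r.1 ∉ range r.2.1}.indicator 1 (s, q)) (measurable_one.indicator hm)
  convert! this using 2 with q
  rw [← ENNReal.tsum_set_one, tsum_subtype _ (fun _ => (1 : ℝ≥0∞)),
    tsum_subtype q.2.carrier (fun s => {r : S × ((Fin n → S) × PointConfig S) |
      r.1 ∈ A ∧ r.1 ∉ range r.2.1}.indicator 1 (s, q))]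
  refine tsum_congr fun s => ?_
  by_cases h1 : s ∈ q.2.carrier <;> by_cases h2 : s ∈ A <;> by_cases h3 : s ∈ range q.1 <;>
    simp [indicator, remove, h1, h2, -mem_range, h3]

end Tuples
end PointConfig

/-! ### The law of the marked configuration -/

instance {S : Type*} (p : S → I) : IsProbabilityMeasure (indepMarkLaw p) := by
  unfold indepMarkLaw; infer_instance

/-- The probability `p s` or `1 - p s` that the mark of the point `s` equals `c`. -/
noncomputable def markProb {S : Type*} (p : S → I) (c : Fin 2) (s : S) : ℝ≥0∞ :=
  bernoulliMeasure (1 : Fin 2) 0 (p s) {c}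

lemma markProb_one {S : Type*} (p : S → I) (s : S) : markProb p 1 s = ENNReal.ofReal (p s) := by
  rw [markProb, bernoulliMeasure_apply _ (measurableSet_singleton _)]
  simpa using (ENNReal.ofReal_coe_nnreal (p := unitInterval.toNNReal (p s))).symm

lemma markProb_zero {S : Type*} (p : S → I) (s : S) :
    markProb p 0 s = ENNReal.ofReal (1 - p s) := by
  rw [markProb, bernoulliMeasure_apply _ (measurableSet_singleton _)]
  simpa using (ENNReal.ofReal_coe_nnreal (p := unitInterval.toNNReal (σ (p s)))).symm

lemma measurable_markProb {S : Type*} [MeasurableSpace S] {p : S → I} (hp : Measurable p)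
    (c : Fin 2) : Measurable (markProb p c) := by
  fin_cases c
  · change Measurable fun s => markProb p 0 s
    simp only [markProb_zero]; fun_prop
  · change Measurable fun s => markProb p 1 s
    simp only [markProb_one]; fun_prop

lemma indepMarkLaw_pi {S : Type*} (p : S → I) (F : Finset S) (t : S → Set (Fin 2)) :
    indepMarkLaw p {m | ∀ s ∈ F, m s ∈ t s} =
      ∏ s ∈ F, bernoulliMeasure (1 : Fin 2) 0 (p s) (t s) :=
  Measure.infinitePi_pi _ (s := F) (t := t) fun _ _ => .of_discrete

namespace PointConfig

section

variable {S : Type*} [PseudoMetricSpace S] [MeasurableSpace S]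

/-- Only the marks of the points of `x` are used by the marking of `x`, which is why it is
measurable for any `σ`-algebra that makes these marks measurable. -/
lemma measurable_mark_of_measurable_eval (x : PointConfig S) {m𝓕 : MeasurableSpace (S → Fin 2)}
    (h : ∀ s ∈ x.carrier, Measurable fun m : S → Fin 2 => m s) : Measurable x.mark := by
  refine measurable_of_encard_toENNReal fun A hA => ?_
  have key (m : S → Fin 2) : (((x.mark m).carrier ∩ A).encard : ℝ≥0∞) =
      ∑' s : x.carrier, A.indicator 1 ((s : S), m s) := by
    have : (x.mark m).carrier ∩ A = (fun s => (s, m s)) '' (x.carrier ∩ {s | (s, m s) ∈ A}) :=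
      (image_inter_preimage (fun s => (s, m s)) x.carrier A).symm
    rw [this, Function.Injective.encard_image fun a b hab => (Prod.ext_iff.1 hab).1,
      ← ENNReal.tsum_set_one, tsum_subtype _ (fun _ => (1 : ℝ≥0∞)), ← indicator_indicator,
      ← tsum_subtype x.carrier]
    rfl
  simp only [key]
  have := x.countable_carrier.to_subtype
  refine Measurable.tsum fun s => ?_
  exact (measurable_from_top
    (f := fun i : Fin 2 => A.indicator (1 : S × Fin 2 → ℝ≥0∞) ((s : S), i))).comp (h s s.2)

lemma measurable_mark (x : PointConfig S) : Measurable x.mark :=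
  measurable_mark_of_measurable_eval x fun _ _ => measurable_pi_apply _

/-- The product is the exponential of a sum over the points unless some factor vanishes. -/
lemma measurable_prod_inter [OpensMeasurableSpace S] {B : Set S} (hB : Bornology.IsBounded B)
    (hBm : MeasurableSet B) {g : S → ℝ≥0∞} (hg : Measurable g) (hg1 : ∀ s, g s ≤ 1) :
    Measurable fun x : PointConfig S => ∏ s ∈ (x.finite_inter B hB).toFinset, g s := by
  let φ (s : S) : ℝ≥0∞ := ENNReal.ofReal (-Real.log (g s).toReal)
  have hφ : Measurable φ := by fun_prop
  have hZ : MeasurableSet (B ∩ {s | g s = 0}) := hBm.inter (hg (measurableSet_singleton 0))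
  have key : (fun x : PointConfig S => ∏ s ∈ (x.finite_inter B hB).toFinset, g s) =
      (void (B ∩ {s | g s = 0})).indicator fun x : PointConfig S =>
        ENNReal.ofReal (Real.exp (-(∑' s : x.carrier, B.indicator φ s).toReal)) := by
    ext1 x
    set F := (x.finite_inter B hB).toFinset with hF
    have hFm (s : S) : s ∈ F ↔ s ∈ x.carrier ∩ B := by simp [hF]
    by_cases h : x ∈ void (B ∩ {s | g s = 0})
    · have h0 (s : S) (hs : s ∈ F) : g s ≠ 0 := fun h0 =>
        notMem_empty s (h.subset ⟨((hFm s).1 hs).1, ((hFm s).1 hs).2, h0⟩)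
      have hsum : ∑' s : x.carrier, B.indicator φ s = ∑ s ∈ F, φ s := by
        rw [tsum_subtype x.carrier, indicator_indicator, ← tsum_subtype, ← F.tsum_subtype,
          show x.carrier ∩ B = F from by ext s; simp [hFm]]
        rfl
      rw [indicator_of_mem h, hsum, ENNReal.toReal_sum (by simp [φ]), ← Finset.sum_neg_distrib,
        Real.exp_sum, ENNReal.ofReal_prod_of_nonneg fun _ _ => (Real.exp_pos _).le]
      refine Finset.prod_congr rfl fun s hs => ?_
      have h1 : (g s).toReal ≤ 1 :=
        ENNReal.toReal_le_of_le_ofReal zero_le_one (by simpa using hg1 s)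
      have htop : g s ≠ ⊤ := ((hg1 s).trans_lt ENNReal.one_lt_top).ne
      have hpos : 0 < (g s).toReal := ENNReal.toReal_pos (h0 s hs) htop
      rw [ENNReal.toReal_ofReal (by simpa using Real.log_nonpos hpos.le h1), neg_neg,
        Real.exp_log hpos, ENNReal.ofReal_toReal htop]
    · rw [indicator_of_notMem h]
      obtain ⟨s, hs⟩ := nonempty_iff_ne_empty.2 h
      exact Finset.prod_eq_zero ((hFm s).2 ⟨hs.1, hs.2.1⟩) hs.2.2
  rw [key]
  refine Measurable.indicator ?_ (measurableSet_void hZ)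
  have := measurable_tsum_points (S := S) measurable_id (f := fun s (_ : PointConfig S) =>
    B.indicator φ s) ((hφ.indicator hBm).comp measurable_fst)
  simp only [id] at this
  fun_prop

end

section Kernel

variable {S : Type*} [MetricSpace S] [MeasurableSpace S] [BorelSpace S]

/-- The probability that the marked points avoid a set is the limit, along an exhaustion by bounded
sets, of finite products over the points of the configuration. -/
lemma measurable_indepMarkLaw_void {p : S → I} (hp : Measurable p) {A : Set (S × Fin 2)}
    (hA : MeasurableSet A) :
    Measurable fun x : PointConfig S => indepMarkLaw p {m | x.mark m ∈ void A} := by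
  rcases isEmpty_or_nonempty S with h | ⟨⟨o⟩⟩
  · have (x : PointConfig S) : x = ⟨∅, by simp⟩ := by
      ext s; exact h.elim s
    have : (fun x : PointConfig S => indepMarkLaw p {m | x.mark m ∈ void A}) =
        fun _ => indepMarkLaw p {m | (⟨∅, by simp⟩ : PointConfig S).mark m ∈ void A} := by
      ext1 x; rw [this x]
    rw [this]; exact measurable_const
  let B (k : ℕ) : Set S := Metric.ball o k
  have hB (k) : Bornology.IsBounded (B k) := Metric.isBounded_ball
  let g (s : S) : ℝ≥0∞ := bernoulliMeasure (1 : Fin 2) 0 (p s) {i | (s, i) ∉ A}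
  have hg : Measurable g := by
    have (s : S) : g s = ∑ i : Fin 2, Aᶜ.indicator (fun q => markProb p q.2 q.1) (s, i) := by
      classical
      have h1 : {i | (s, i) ∉ A} = ((Finset.univ.filter fun i => (s, i) ∉ A : Finset (Fin 2)) :
        Set (Fin 2)) := by ext i; simp
      simp only [g, h1, ← sum_measure_singleton, Finset.sum_filter, indicator,
        mem_compl_iff, markProb]
    rw [funext this]
    refine Finset.measurable_fun_sum _ fun i _ => ?_
    refine Measurable.comp (g := Aᶜ.indicator fun q => markProb p q.2 q.1)
      (Measurable.indicator ?_ hA.compl) (by fun_prop)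
    refine measurable_from_prod_countable_left fun i => ?_
    exact measurable_markProb hp i
  let T (x : PointConfig S) (k : ℕ) : Set (S → Fin 2) :=
    {m | ∀ s ∈ (x.finite_inter (B k) (hB k)).toFinset, m s ∈ {i | (s, i) ∉ A}}
  have key (x : PointConfig S) : indepMarkLaw p {m | x.mark m ∈ void A} =
      ⨅ k, ∏ s ∈ (x.finite_inter (B k) (hB k)).toFinset, g s := by
    have h1 : {m | x.mark m ∈ void A} = ⋂ k, T x k := by
      ext m
      simp only [T, mem_iInter, mem_ofPred_eq, Finite.mem_toFinset, void, mark,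
        eq_empty_iff_forall_notMem]
      constructor
      · intro h k s hs hsA
        exact h (s, m s) ⟨⟨s, hs.1, rfl⟩, hsA⟩
      · rintro h _ ⟨⟨s, hs, rfl⟩, hsA⟩
        obtain ⟨k, hk⟩ := exists_nat_gt (dist s o)
        exact h k s ⟨hs, hk⟩ hsA
    have hTm (k) : MeasurableSet (T x k) := by
      have : T x k = ⋂ s ∈ (x.finite_inter (B k) (hB k)).toFinset,
          {m | m s ∈ {i | (s, i) ∉ A}} := by
        ext m; simp [T]
      rw [this]
      exact Finset.measurableSet_biInter _ fun s _ => measurable_pi_apply s .of_discrete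
    have hTa : Antitone (T x) := by
      intro k l hkl m hm s hs
      refine hm s ?_
      simp only [Finite.mem_toFinset] at hs ⊢
      exact ⟨hs.1, Metric.ball_subset_ball (by exact_mod_cast hkl) hs.2⟩
    rw [h1, hTa.measure_iInter (fun k => (hTm k).nullMeasurableSet) ⟨0, measure_ne_top _ _⟩]
    exact iInf_congr fun k => indepMarkLaw_pi p _ _
  simp only [key]
  exact Measurable.iInf fun k => measurable_prod_inter (hB k) Metric.isOpen_ball.measurableSet hg
    fun s => prob_le_one

variable [SecondCountableTopology S]

/-- The kernel assigning to a configuration the law of its independent marking. -/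
noncomputable def markKernel (p : S → I) (hp : Measurable p) :
    Kernel (PointConfig S) (PointConfig (S × Fin 2)) where
  toFun x := (indepMarkLaw p).map x.mark
  measurable' := by
    have (x : PointConfig S) : IsProbabilityMeasure ((indepMarkLaw p).map x.mark) :=
      Measure.isProbabilityMeasure_map x.measurable_mark.aemeasurable
    refine .measure_of_isPiSystem_of_isProbabilityMeasure generateFrom_void isPiSystem_void ?_
    rintro _ ⟨A, hA, rfl⟩
    simp only [fun x : PointConfig S => Measure.map_apply (μ := indepMarkLaw p) x.measurable_mark
      (measurableSet_void hA)]
    exact measurable_indepMarkLaw_void hp hA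

variable {p : S → I} {hp : Measurable p}

lemma markKernel_apply (x : PointConfig S) :
    markKernel p hp x = (indepMarkLaw p).map x.mark := rfl

instance : IsMarkovKernel (markKernel p hp) :=
  ⟨fun x => Measure.isProbabilityMeasure_map x.measurable_mark.aemeasurable⟩

lemma lintegral_markKernel (x : PointConfig S) {F : PointConfig (S × Fin 2) → ℝ≥0∞}
    (hF : Measurable F) : ∫⁻ y, F y ∂markKernel p hp x = ∫⁻ m, F (x.mark m) ∂indepMarkLaw p :=
  lintegral_map hF x.measurable_mark

/-- The marks of finitely many points are independent of the marked configuration formed by other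
points. -/
lemma lintegral_indicator_mul_mark {n : ℕ} {u : Fin n → S} (hu : Function.Injective u)
    (c : Fin 2) {y : PointConfig S} (hy : ∀ s ∈ y.carrier, s ∉ range u)
    {F : PointConfig (S × Fin 2) → ℝ≥0∞} (hF : Measurable F) :
    ∫⁻ m, {m : S → Fin 2 | ∀ i, m (u i) = c}.indicator 1 m * F (y.mark m) ∂indepMarkLaw p =
      (∏ i, markProb p c (u i)) * ∫⁻ z, F z ∂markKernel p hp y := by
  let 𝓖 (s : S) : MeasurableSpace (S → Fin 2) := MeasurableSpace.comap (fun m => m s) inferInstance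
  have h𝓖 (s : S) : 𝓖 s ≤ MeasurableSpace.pi := (measurable_pi_apply s).comap_le
  have hind : iIndep 𝓖 (indepMarkLaw p) :=
    iIndepFun_infinitePi (P := fun s => bernoulliMeasure (1 : Fin 2) 0 (p s))
      (X := fun _ i => i) fun _ => measurable_id
  have hle (T : Set S) : ⨆ s ∈ T, 𝓖 s ≤ MeasurableSpace.pi := iSup₂_le fun s _ => h𝓖 s
  have hev (T : Set S) (s : S) (hs : s ∈ T) : Measurable[⨆ s ∈ T, 𝓖 s] fun m : S → Fin 2 => m s :=
    measurable_iff_comap_le.2 (le_iSup₂ (f := fun s (_ : s ∈ T) => 𝓖 s) s hs)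
  have hM (𝓕 : MeasurableSpace (S → Fin 2)) (h : ∀ i, Measurable[𝓕] fun m : S → Fin 2 => m (u i)) :
      MeasurableSet[𝓕] {m : S → Fin 2 | ∀ i, m (u i) = c} := by
    have : {m : S → Fin 2 | ∀ i, m (u i) = c} = ⋂ i, (fun m => m (u i)) ⁻¹' {c} := by
      ext m; simp
    rw [this]
    exact MeasurableSet.iInter fun i => h i (measurableSet_singleton c)
  rw [lintegral_mul_eq_lintegral_mul_lintegral_of_independent_measurableSpace
    (hle (range u)) (hle (range u)ᶜ) (indep_iSup_of_disjoint h𝓖 hind disjoint_compl_right),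
    lintegral_markKernel y hF, lintegral_indicator_one (hM _ fun i => measurable_pi_apply _)]
  · congr 1
    have := indepMarkLaw_pi p (Finset.univ.map ⟨u, hu⟩) fun _ => {c}
    rw [Finset.prod_map] at this
    convert! this using 2
    ext m; simp
  · exact @Measurable.indicator _ _ _ _ _ _ _ measurable_const
      (hM _ fun i => hev _ _ (mem_range_self i))
  · exact hF.comp (measurable_mark_of_measurable_eval y fun s hs => hev _ s (hy s hs))

end Kernel

end PointConfig

/-! ### Jointly measurable conditional expectations -/

section CondLExp

variable {α Ω T : Type*} [MeasurableSpace α] [MeasurableSpace Ω] [MeasurableSpace T]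
  {P : Measure Ω} [IsProbabilityMeasure P] {W : Ω → T}

/-- No standard Borel assumption is needed, since only one function is conditioned, depending
measurably on the parameter: this is a monotone class argument starting from product sets. -/
lemma exists_measurable_condLExp_indicator (hW : Measurable W) {D : Set (α × Ω)}
    (hD : MeasurableSet D) :
    ∃ g : α × T → ℝ≥0∞, Measurable g ∧ ∀ a, (fun ω => g (a, W ω)) =ᵐ[P]
      condLExp (MeasurableSpace.comap W inferInstance) P fun ω => D.indicator 1 (a, ω) := by
  have hle : MeasurableSpace.comap W inferInstance ≤ (inferInstance : MeasurableSpace Ω) :=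
    hW.comap_le
  have hsec {D : Set (α × Ω)} (hD : MeasurableSet D) (a : α) :
      Measurable fun ω => D.indicator (1 : α × Ω → ℝ≥0∞) (a, ω) :=
    (measurable_one.indicator hD).comp measurable_prodMk_left
  induction D, hD using MeasurableSpace.induction_on_inter generateFrom_prod.symm
    isPiSystem_prod with
  | empty =>
    refine ⟨0, measurable_zero, fun a => ?_⟩
    simp only [indicator_empty]
    rw [condLExp_const hle]
    rfl
  | basic D hD =>
    obtain ⟨A, hA, B, hB, rfl⟩ := hD
    obtain ⟨g, hg, hgW⟩ := (measurable_condLExp (MeasurableSpace.comap W inferInstance) P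
      (B.indicator 1)).exists_eq_measurable_comp
    refine ⟨fun q => A.indicator 1 q.1 * g q.2, ?_, fun a => ?_⟩
    · exact ((measurable_one.indicator hA).comp measurable_fst).mul (hg.comp measurable_snd)
    · by_cases ha : a ∈ A
      · have : (fun ω => (A ×ˢ B).indicator (1 : α × Ω → ℝ≥0∞) (a, ω)) = B.indicator 1 := by
          ext ω
          by_cases hω : ω ∈ B <;> simp [ha, hω]
        rw [this, hgW]
        simp [ha, Function.comp_def]
      · have : (fun ω => (A ×ˢ B).indicator (1 : α × Ω → ℝ≥0∞) (a, ω)) = fun _ => 0 := by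
          ext ω; simp [ha]
        rw [this, condLExp_const hle]
        simp [ha]
  | compl D hD ih =>
    obtain ⟨g, hg, hgW⟩ := ih
    refine ⟨fun q => 1 - g q, by fun_prop, fun a => ?_⟩
    have h1 := condLExp_add_left (mΩ := MeasurableSpace.comap W inferInstance)
      (fun ω => Dᶜ.indicator (1 : α × Ω → ℝ≥0∞) (a, ω)) (hsec hD a).aemeasurable (P := P)
    have h2 : ((fun ω => D.indicator (1 : α × Ω → ℝ≥0∞) (a, ω)) +
        fun ω => Dᶜ.indicator (1 : α × Ω → ℝ≥0∞) (a, ω)) = 1 := by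
      ext ω
      by_cases h : (a, ω) ∈ D <;> simp [h]
    rw [h2, condLExp_one hle] at h1
    have h3 := condLExp_ne_top (mΩ := MeasurableSpace.comap W inferInstance) (P := P)
      (f := fun ω => D.indicator (1 : α × Ω → ℝ≥0∞) (a, ω)) (by
        refine ((lintegral_mono (g := 1) fun ω => ?_).trans_lt (by simp)).ne
        exact indicator_le_self _ _ _)
    filter_upwards [h1, h3, hgW a] with ω h1 h3 h4
    rw [h4]
    simp only [Pi.one_apply, Pi.add_apply] at h1
    rw [h1, ENNReal.add_sub_cancel_left h3]
  | iUnion D hd hD ih =>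
    choose g hg hgW using ih
    refine ⟨fun q => ∑' i, g i q, .tsum hg, fun a => ?_⟩
    have h1 := condLExp_tsum (MeasurableSpace.comap W inferInstance) (P := P)
      fun i => (hsec (hD i) a).aemeasurable
    have h2 : (∑' i, fun ω => (D i).indicator (1 : α × Ω → ℝ≥0∞) (a, ω)) =
        fun ω => (⋃ i, D i).indicator 1 (a, ω) := by
      ext ω
      rw [ENNReal.tsum_apply]
      by_cases h : (a, ω) ∈ ⋃ i, D i
      · obtain ⟨i, hi⟩ := mem_iUnion.1 h
        rw [indicator_of_mem h, tsum_eq_single i fun j hj =>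
          indicator_of_notMem (disjoint_right.1 (hd hj) hi) _, indicator_of_mem hi]
      · rw [indicator_of_notMem h, ENNReal.tsum_eq_zero]
        exact fun i => indicator_of_notMem (fun hi => h (mem_iUnion.2 ⟨i, hi⟩)) _
    rw [h2] at h1
    filter_upwards [h1, ae_all_iff.2 fun i => hgW i a] with ω h1 h3
    rw [h1, ENNReal.tsum_apply]
    exact tsum_congr h3

lemma exists_measurable_condLExp (hW : Measurable W) {f : α × Ω → ℝ≥0∞} (hf : Measurable f) :
    ∃ g : α × T → ℝ≥0∞, Measurable g ∧ ∀ a, (fun ω => g (a, W ω)) =ᵐ[P]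
      condLExp (MeasurableSpace.comap W inferInstance) P fun ω => f (a, ω) := by
  have hle : MeasurableSpace.comap W inferInstance ≤ (inferInstance : MeasurableSpace Ω) :=
    hW.comap_le
  refine Measurable.ennreal_induction (motive := fun f => ∃ g : α × T → ℝ≥0∞, Measurable g ∧
    ∀ a, (fun ω => g (a, W ω)) =ᵐ[P]
      condLExp (MeasurableSpace.comap W inferInstance) P fun ω => f (a, ω)) ?_ ?_ ?_ hf
  · intro c D hD
    obtain ⟨g, hg, hgW⟩ := exists_measurable_condLExp_indicator (P := P) hW hD
    refine ⟨fun q => c * g q, by fun_prop, fun a => ?_⟩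
    have h1 := condLExp_smul (mΩ := MeasurableSpace.comap W inferInstance) (P := P)
      (fun ω => D.indicator 1 (a, ω))
      ((measurable_one.indicator hD).comp measurable_prodMk_left).aemeasurable c
    have h2 : (c • fun ω => D.indicator (1 : α × Ω → ℝ≥0∞) (a, ω)) =
        fun ω => D.indicator (fun _ => c) (a, ω) := by
      ext ω
      by_cases h : (a, ω) ∈ D <;> simp [h]
    rw [h2] at h1
    filter_upwards [h1, hgW a] with ω h1 h3
    rw [h1, h3]
    rfl
  · rintro f₁ f₂ _ hf₁ hf₂ ⟨g₁, hg₁, hgW₁⟩ ⟨g₂, hg₂, hgW₂⟩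
    refine ⟨g₁ + g₂, hg₁.add hg₂, fun a => ?_⟩
    have h1 := condLExp_add_left (mΩ := MeasurableSpace.comap W inferInstance) (P := P)
      (X := fun ω => f₁ (a, ω)) (fun ω => f₂ (a, ω))
      (hf₁.comp measurable_prodMk_left).aemeasurable
    filter_upwards [h1, hgW₁ a, hgW₂ a] with ω h1 h2 h3
    refine Eq.trans ?_ h1.symm
    simp only [Pi.add_apply, h2, h3]
  · intro f hf hmono ih
    choose g hg hgW using ih
    refine ⟨fun q => ⨆ n, g n q, .iSup hg, fun a => ?_⟩
    refine ae_eq_condLExp hle _ _ ?_ fun s hs => ?_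
    · exact (Measurable.iSup fun n => (hg n).comp measurable_prodMk_left).comp
        (comap_measurable W)
    have hm : ∀ᵐ ω ∂P, Monotone fun n => g n (a, W ω) := by
      have : ∀ n, ∀ᵐ ω ∂P, g n (a, W ω) ≤ g (n + 1) (a, W ω) := fun n => by
        have h := condLExp_mono (mΩ := MeasurableSpace.comap W inferInstance) (P := P)
          (ae_of_all _ fun ω => hmono n.le_succ (a, ω))
        filter_upwards [h, hgW n a, hgW (n + 1) a] with ω h h1 h2
        rw [h1, h2]; exact h
      filter_upwards [ae_all_iff.2 this] with ω h
      exact monotone_nat_of_le_succ h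
    rw [lintegral_iSup' (fun n => by fun_prop) (ae_restrict_of_ae hm),
      lintegral_iSup (f := fun n ω => f n (a, ω)) (fun n => by fun_prop) fun m n hmn ω =>
        hmono hmn _]
    refine iSup_congr fun n => ?_
    exact (lintegral_congr_ae (ae_restrict_of_ae (hgW n a))).trans
      (setLIntegral_condLExp hle P _ hs)

/-- Conditional expectations of a family of functions are identified by integrating out the
parameter as well. -/
lemma ae_condLExp_eq_of_lintegral_eq {ν : Measure α} [SigmaFinite ν] (hW : Measurable W)
    {f : α → Ω → ℝ≥0∞} (hf : Measurable (Function.uncurry f)) {g : α → T → ℝ≥0∞}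
    (hg : Measurable (Function.uncurry g))
    (h : ∀ D : Set (α × T), MeasurableSet D →
      ∫⁻ a, ∫⁻ ω, D.indicator 1 (a, W ω) * f a ω ∂P ∂ν =
        ∫⁻ a, ∫⁻ ω, D.indicator 1 (a, W ω) * g a (W ω) ∂P ∂ν) :
    ∀ᵐ a ∂ν, condLExp (MeasurableSpace.comap W inferInstance) P (f a) =ᵐ[P]
      fun ω => g a (W ω) := by
  have hle : MeasurableSpace.comap W inferInstance ≤ (inferInstance : MeasurableSpace Ω) :=
    hW.comap_le
  have : IsProbabilityMeasure (P.map W) := Measure.isProbabilityMeasure_map hW.aemeasurable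
  obtain ⟨k, hk, hkW⟩ := exists_measurable_condLExp (P := P) hW hf
  have hind (D : Set (α × T)) (a : α) (φ : Ω → ℝ≥0∞) (ω : Ω) :
      D.indicator 1 (a, W ω) * φ ω = (W ⁻¹' (Prod.mk a ⁻¹' D)).indicator φ ω := by
    by_cases hω : (a, W ω) ∈ D <;> simp [indicator, hω]
  have key (D : Set (α × T)) (hD : MeasurableSet D) {φ : α × T → ℝ≥0∞} (hφ : Measurable φ) :
      ∫⁻ q in D, φ q ∂ν.prod (P.map W) =
        ∫⁻ a, ∫⁻ ω, D.indicator 1 (a, W ω) * φ (a, W ω) ∂P ∂ν := by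
    rw [← lintegral_indicator hD, lintegral_prod _ (hφ.indicator hD).aemeasurable]
    refine lintegral_congr fun a => ?_
    rw [lintegral_map (f := fun y => D.indicator φ (a, y))
      ((hφ.indicator hD).comp measurable_prodMk_left) hW]
    refine lintegral_congr fun ω => ?_
    by_cases hω : (a, W ω) ∈ D <;> simp [hω]
  have hkg : k =ᵐ[ν.prod (P.map W)] Function.uncurry g := by
    refine ae_eq_of_forall_setLIntegral_eq_of_sigmaFinite hk hg fun D hD _ => ?_
    rw [key D hD hk, key D hD hg]
    refine Eq.trans ?_ (h D hD)
    refine lintegral_congr fun a => ?_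
    have hm : MeasurableSet (Prod.mk a ⁻¹' D) := measurable_prodMk_left hD
    rw [lintegral_congr (hind D a fun ω => k (a, W ω)), lintegral_congr (hind D a (f a)),
      lintegral_indicator (hW hm), lintegral_indicator (hW hm),
      ← setLIntegral_condLExp hle P (f a) ⟨_, hm, rfl⟩]
    exact lintegral_congr_ae (ae_restrict_of_ae (hkW a))
  filter_upwards [Measure.ae_ae_of_ae_prod hkg] with a ha
  filter_upwards [hkW a, ae_of_ae_map hW.aemeasurable ha] with ω h1 h2
  exact h1.symm.trans h2

end CondLExp

/-! ### The joint law of a point process and its marking -/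

namespace IsIndepThinning

open PointConfig

variable {S Ω : Type*} [MetricSpace S] [SecondCountableTopology S] [MeasurableSpace S]
  [BorelSpace S] [MeasurableSpace Ω] {P : Measure Ω} [IsProbabilityMeasure P] {p : S → I}
  {X Z : Ω → PointConfig S} {Xb : Ω → PointConfig (S × Fin 2)}

lemma map_prodMk (hZ : IsIndepThinning P p X Xb Z) (hp : Measurable p) :
    P.map (fun ω => (X ω, Xb ω)) = (P.map X) ⊗ₘ markKernel p hp := by
  have hX := hZ.measurable_ground
  have hXb := hZ.measurable_marked
  have : IsProbabilityMeasure (P.map X) := Measure.isProbabilityMeasure_map hX.aemeasurable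
  have : IsProbabilityMeasure (P.map fun ω => (X ω, Xb ω)) :=
    Measure.isProbabilityMeasure_map (hX.prodMk hXb).aemeasurable
  refine Measure.ext_prod fun {C E} hC hE => ?_
  rw [Measure.compProd_apply_prod hC hE, Measure.map_apply (hX.prodMk hXb) (hC.prod hE),
    setLIntegral_map hC ((markKernel p hp).measurable_coe hE) hX]
  have h1 := setIntegral_condExp (μ := P) hX.comap_le (f := (Xb ⁻¹' E).indicator fun _ => (1 : ℝ))
    ((integrable_const 1).indicator (hXb hE)) ⟨C, hC, rfl⟩
  rw [integral_congr_ae (ae_restrict_of_ae (hZ.cond_law E hE))] at h1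
  have h2 (ω : Ω) : (indepMarkLaw p).real {m | (X ω).mark m ∈ E} =
      (markKernel p hp (X ω) E).toReal := by
    rw [markKernel_apply, Measure.map_apply (measurable_mark _) hE]; rfl
  simp only [h2] at h1
  rw [integral_toReal (f := fun ω => markKernel p hp (X ω) E)
    (((markKernel p hp).measurable_coe hE).comp hX).aemeasurable
    (ae_of_all _ fun ω => measure_lt_top _ _), integral_indicator_const _ (hXb hE), smul_eq_mul,
    mul_one, measureReal_def, Measure.restrict_apply (hXb hE), ENNReal.toReal_eq_toReal_iff'] at h1
  · rw [h1, inter_comm]; rfl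
  · refine ((setLIntegral_mono_ae' (g := 1) (hX hC) ?_).trans_lt ?_).ne
    · exact ae_of_all _ fun ω _ => prob_le_one
    · simp
  · exact measure_ne_top _ _

lemma lintegral_prodMk (hZ : IsIndepThinning P p X Xb Z) (hp : Measurable p)
    {G : PointConfig S × PointConfig (S × Fin 2) → ℝ≥0∞} (hG : Measurable G) :
    ∫⁻ ω, G (X ω, Xb ω) ∂P = ∫⁻ ω, ∫⁻ y, G (X ω, y) ∂markKernel p hp (X ω) ∂P := by
  have hX := hZ.measurable_ground
  have : IsProbabilityMeasure (P.map X) := Measure.isProbabilityMeasure_map hX.aemeasurable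
  rw [← lintegral_map hG (hX.prodMk hZ.measurable_marked), hZ.map_prodMk hp,
    Measure.lintegral_compProd hG, lintegral_map hG.lintegral_kernel_prod_right' hX]

end IsIndepThinning

/-! ### Campbell formulas for the thinned process -/

namespace PointConfig

section

variable {S : Type*} [Bornology S]

lemma mem_withMark_mark {x : PointConfig S} {m : S → Fin 2} {c : Fin 2} {s : S} :
    s ∈ (x.mark m).withMark c ↔ s ∈ x ∧ m s = c := by
  constructor
  · rintro ⟨t, ht, he⟩
    obtain ⟨rfl, rfl⟩ := Prod.mk.inj he
    exact ⟨ht, rfl⟩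
  · rintro ⟨hs, rfl⟩
    exact ⟨s, hs, rfl⟩

lemma withMark_mark_remove (x : PointConfig S) (m : S → Fin 2) (c : Fin 2) (B : Set S) :
    ((x.mark m).withMark c).remove B = ((x.remove B).mark m).withMark c := by
  ext s
  change s ∈ (x.mark m).withMark c ∧ s ∉ B ↔ s ∈ ((x.remove B).mark m).withMark c
  rw [mem_withMark_mark, mem_withMark_mark]
  exact ⟨fun h => ⟨⟨h.1.1, h.2⟩, h.1.2⟩, fun h => ⟨⟨h.1.1, h.2⟩, h.1.2⟩⟩

lemma mem_distinctTuples_withMark_mark {x : PointConfig S} {m : S → Fin 2} {c : Fin 2} {n : ℕ}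
    {u : Fin n → S} : u ∈ ((x.mark m).withMark c).distinctTuples n ↔
      u ∈ x.distinctTuples n ∧ ∀ i, m (u i) = c := by
  simp only [distinctTuples, mem_ofPred_eq, mem_withMark_mark, forall_and, and_assoc]

lemma sdiff_remove_range (x z : PointConfig S) {n : ℕ} (u : z.distinctTuples n) :
    (x \ z).remove (range u.1) = x \ z := by
  ext s
  refine ⟨fun h => h.1, fun h => ⟨h, ?_⟩⟩
  rintro ⟨i, rfl⟩
  exact h.2 (u.2.2 i)

/-- The marked configuration determines the retained tuples as the tuples of points with mark `1`,
whose removal does not affect the points with mark `0`. -/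
lemma tsum_distinctTuples_indicator_mark_one (y : PointConfig (S × Fin 2)) {n : ℕ}
    (h : (Fin n → S) → PointConfig S → ℝ≥0∞) :
    ∑' w : y.distinctTuples n, {w : Fin n → S × Fin 2 | ∀ i, (w i).2 = 1}.indicator
        (fun w => h (fun i => (w i).1) ((y.remove (range w)).withMark 0)) w =
      ∑' u : (y.withMark 1).distinctTuples n, h u (y.withMark 0) := by
  let e (u : Fin n → S) : Fin n → S × Fin 2 := fun i => (u i, 1)
  have he : Function.Injective e := fun u v huv => funext fun i => (Prod.mk.inj (congrFun huv i)).1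
  rw [tsum_subtype (y.distinctTuples n) ({w : Fin n → S × Fin 2 | ∀ i, (w i).2 = 1}.indicator
      (fun w => h (fun i => (w i).1) ((y.remove (range w)).withMark 0))),
    tsum_subtype ((y.withMark 1).distinctTuples n) (fun u => h u (y.withMark 0)),
    indicator_indicator, ← he.tsum_eq]
  · refine tsum_congr fun u => ?_
    have h1 : e u ∈ y.distinctTuples n ∩ {w | ∀ i, (w i).2 = 1} ↔
        u ∈ (y.withMark 1).distinctTuples n := by
      refine ⟨fun H => ⟨fun i j hij => H.1.1 (Prod.ext hij rfl), H.1.2⟩,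
        fun H => ⟨⟨fun i j hij => H.1 (Prod.mk.inj hij).1, H.2⟩, fun i => rfl⟩⟩
    have h2 : (y.remove (range (e u))).withMark 0 = y.withMark 0 := by
      ext s
      refine ⟨fun H => H.1, fun H => ⟨H, ?_⟩⟩
      rintro ⟨i, hi⟩
      exact one_ne_zero (Prod.mk.inj hi).2
    by_cases hu : u ∈ (y.withMark 1).distinctTuples n
    · rw [indicator_of_mem hu, indicator_of_mem (h1.2 hu), h2]
    · rw [indicator_of_notMem hu, indicator_of_notMem (mt h1.1 hu)]
  · intro w hw
    have hw' := (mem_of_indicator_ne_zero hw).2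
    exact ⟨fun i => (w i).1, funext fun i => Prod.ext rfl (hw' i).symm⟩

end

variable {S : Type*} [MetricSpace S] [MeasurableSpace S] [BorelSpace S]
  [SecondCountableTopology S] {p : S → I} {hp : Measurable p}

lemma lintegral_tsum_withMark_mark (x : PointConfig S) {n : ℕ} (c d : Fin 2)
    {h : (Fin n → S) → PointConfig S → ℝ≥0∞} (hh : ∀ u, Measurable (h u)) :
    ∫⁻ m, ∑' u : ((x.mark m).withMark c).distinctTuples n,
        h u (((x.mark m).withMark d).remove (range u.1)) ∂indepMarkLaw p =
      ∑' u : x.distinctTuples n, (∏ i, markProb p c (u.1 i)) *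
        ∫⁻ z, h u (z.withMark d) ∂markKernel p hp (x.remove (range u.1)) := by
  have key (m : S → Fin 2) : ∑' u : ((x.mark m).withMark c).distinctTuples n,
      h u (((x.mark m).withMark d).remove (range u.1)) =
      ∑' u : x.distinctTuples n, {m : S → Fin 2 | ∀ i, m (u.1 i) = c}.indicator 1 m *
        h u (((x.remove (range u.1)).mark m).withMark d) := by
    rw [tsum_subtype (((x.mark m).withMark c).distinctTuples n)
        (fun u => h u (((x.mark m).withMark d).remove (range u))),
      tsum_subtype (x.distinctTuples n) (fun u => {m : S → Fin 2 | ∀ i, m (u i) = c}.indicator 1 m *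
        h u (((x.remove (range u)).mark m).withMark d))]
    refine tsum_congr fun u => ?_
    by_cases h1 : u ∈ x.distinctTuples n <;> by_cases h2 : ∀ i, m (u i) = c <;>
      simp [indicator, mem_distinctTuples_withMark_mark, withMark_mark_remove, h1, h2]
  simp only [key]
  have := (x.countable_distinctTuples n).to_subtype
  rw [lintegral_tsum]
  · refine tsum_congr fun u => ?_
    exact lintegral_indicator_mul_mark u.2.1 c (y := x.remove (range u.1))
      (fun s (hs : s ∈ x.carrier \ range u.1) => hs.2)
      ((hh u).comp (measurable_withMark d))
  · intro u
    have hM : MeasurableSet {m : S → Fin 2 | ∀ i, m (u.1 i) = c} := by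
      have : {m : S → Fin 2 | ∀ i, m (u.1 i) = c} = ⋂ i, (fun m => m (u.1 i)) ⁻¹' {c} := by
        ext m; simp
      rw [this]
      exact MeasurableSet.iInter fun i => measurable_pi_apply _ (measurableSet_singleton c)
    exact ((measurable_one.indicator hM).mul
      ((hh u).comp ((measurable_withMark d).comp (measurable_mark _)))).aemeasurable

end PointConfig

lemma setOf_forall_mark_one {S : Type*} (n : ℕ) :
    {w : Fin n → S × Fin 2 | ∀ i, (w i).2 = 1} =
      univ.pi fun _ => (univ : Set S) ×ˢ {(1 : Fin 2)} := by
  ext w; simp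

lemma measurableSet_forall_mark_one {S : Type*} [MeasurableSpace S] (n : ℕ) :
    MeasurableSet {w : Fin n → S × Fin 2 | ∀ i, (w i).2 = 1} := by
  rw [setOf_forall_mark_one]
  exact MeasurableSet.univ_pi fun _ => MeasurableSet.univ.prod (measurableSet_singleton _)

/-- Restricting the reference measure of `S × {0, 1}` to tuples with all marks `1` gives back the
reference measure of `S`. -/
lemma lintegral_indicator_mark_one_pi {S : Type*} [MeasurableSpace S] (μ : Measure S)
    [SigmaFinite μ] {n : ℕ} {φ : (Fin n → S × Fin 2) → ℝ≥0∞} (hφ : Measurable φ) :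
    ∫⁻ w, {w : Fin n → S × Fin 2 | ∀ i, (w i).2 = 1}.indicator φ w
        ∂(Measure.pi fun _ : Fin n => μ.prod Measure.count) =
      ∫⁻ u, φ (fun i => (u i, 1)) ∂(Measure.pi fun _ : Fin n => μ) := by
  have h2 : (μ.prod (Measure.count : Measure (Fin 2))).restrict (univ ×ˢ {1}) =
      μ.map fun s => (s, 1) := by
    rw [← Measure.prod_restrict, Measure.restrict_univ, Measure.restrict_singleton,
      Measure.count_singleton, one_smul, Measure.prod_dirac]
  have h3 : SigmaFinite (μ.map fun s => (s, (1 : Fin 2))) := by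
    rw [← Measure.prod_dirac]; infer_instance
  have hs : Measurable fun s : S => (s, (1 : Fin 2)) := by fun_prop
  rw [lintegral_indicator (measurableSet_forall_mark_one n), setOf_forall_mark_one,
    Measure.restrict_pi_pi]
  simp only [h2]
  rw [← Measure.pi_map_pi fun _ => hs.aemeasurable, lintegral_map hφ (by fun_prop)]

/-- A random sum of real numbers with integrable absolute sum is the difference of its positive and
negative parts. -/
lemma summable_and_integrable_tsum {Ω : Type*} [MeasurableSpace Ω] {P : Measure Ω}
    {ι : Ω → Type*} (f : ∀ ω, ι ω → ℝ)
    (hpos : Measurable fun ω => ∑' i, ENNReal.ofReal (f ω i))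
    (hneg : Measurable fun ω => ∑' i, ENNReal.ofReal (-f ω i))
    (hfin : ∫⁻ ω, ∑' i, ‖f ω i‖ₑ ∂P ≠ ⊤) :
    (∀ᵐ ω ∂P, Summable (f ω)) ∧ Integrable (fun ω => ∑' i, f ω i) P ∧
      ∫ ω, ∑' i, f ω i ∂P = (∫⁻ ω, ∑' i, ENNReal.ofReal (f ω i) ∂P).toReal -
        (∫⁻ ω, ∑' i, ENNReal.ofReal (-f ω i) ∂P).toReal := by
  have hsplit (r : ℝ) : ‖r‖ₑ = ENNReal.ofReal r + ENNReal.ofReal (-r) := by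
    rw [Real.enorm_eq_ofReal_abs]
    rcases le_total 0 r with h | h
    · rw [abs_of_nonneg h, ENNReal.ofReal_of_nonpos (neg_nonpos.2 h), add_zero]
    · rw [abs_of_nonpos h, ENNReal.ofReal_of_nonpos h, zero_add]
  simp only [hsplit, ENNReal.tsum_add] at hfin
  rw [lintegral_add_left hpos, ENNReal.add_ne_top] at hfin
  have hs (ω : Ω) (hA : ∑' i, ENNReal.ofReal (f ω i) < ⊤)
      (hB : ∑' i, ENNReal.ofReal (-f ω i) < ⊤) :
      HasSum (f ω) ((∑' i, ENNReal.ofReal (f ω i)).toReal -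
        (∑' i, ENNReal.ofReal (-f ω i)).toReal) := by
    have h1 := (ENNReal.summable_toReal hA.ne).hasSum
    have h2 := (ENNReal.summable_toReal hB.ne).hasSum
    rw [← ENNReal.tsum_toReal_eq fun _ => ENNReal.ofReal_ne_top] at h1 h2
    convert! h1.sub h2 using 1
    ext i
    rcases le_total 0 (f ω i) with h | h
    · simp [ENNReal.toReal_ofReal h, ENNReal.ofReal_of_nonpos (neg_nonpos.2 h)]
    · simp [ENNReal.toReal_ofReal (neg_nonneg.2 h), ENNReal.ofReal_of_nonpos h]
  have hA := ae_lt_top hpos hfin.1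
  have hB := ae_lt_top hneg hfin.2
  have hae : (fun ω => ∑' i, f ω i) =ᵐ[P] fun ω => (∑' i, ENNReal.ofReal (f ω i)).toReal -
      (∑' i, ENNReal.ofReal (-f ω i)).toReal := by
    filter_upwards [hA, hB] with ω h1 h2 using (hs ω h1 h2).tsum_eq
  have hiA := integrable_toReal_of_lintegral_ne_top hpos.aemeasurable hfin.1
  have hiB := integrable_toReal_of_lintegral_ne_top hneg.aemeasurable hfin.2
  refine ⟨?_, (hiA.sub hiB).congr hae.symm, ?_⟩
  · filter_upwards [hA, hB] with ω h1 h2 using (hs ω h1 h2).summable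
  · rw [integral_congr_ae hae, integral_sub hiA hiB, integral_toReal hpos.aemeasurable hA,
      integral_toReal hneg.aemeasurable hB]

namespace IsIndepThinning

open PointConfig

variable {S Ω : Type*} [MetricSpace S] [MeasurableSpace S] [MeasurableSpace Ω] {P : Measure Ω}
  {p : S → I}
  {X Z Y : Ω → PointConfig S} {Xb : Ω → PointConfig (S × Fin 2)}

lemma measurable_thinned (hZ : IsIndepThinning P p X Xb Z) : Measurable Z := by
  rw [funext hZ.retained]
  exact (measurable_withMark 1).comp hZ.measurable_marked

lemma removed_eq_withMark (hZ : IsIndepThinning P p X Xb Z) (hY : ∀ ω, Y ω = X ω \ Z ω) (ω : Ω) :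
    Y ω = (Xb ω).withMark 0 := by
  obtain ⟨m, hm⟩ := hZ.exists_marks ω
  rw [hY, hZ.retained, hm]
  ext s
  change s ∈ X ω ∧ ¬ s ∈ ((X ω).mark m).withMark 1 ↔ s ∈ ((X ω).mark m).withMark 0
  rw [mem_withMark_mark, mem_withMark_mark]
  have : m s = 1 ↔ ¬ m s = 0 := by
    generalize m s = c
    revert c; decide
  tauto

lemma measurable_removed (hZ : IsIndepThinning P p X Xb Z) (hY : ∀ ω, Y ω = X ω \ Z ω) :
    Measurable Y := by
  rw [funext (hZ.removed_eq_withMark hY)]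
  exact (measurable_withMark 0).comp hZ.measurable_marked

variable [SecondCountableTopology S] [BorelSpace S] [IsProbabilityMeasure P]

/-- Campbell formula for the tuples of points with mark `c` and the points with mark `d` of the rest
of the process: given `X`, the marks of a tuple are independent of the other ones. -/
lemma lintegral_tsum_withMark (hZ : IsIndepThinning P p X Xb Z) (hp : Measurable p) {n : ℕ}
    {c d : Fin 2} {A B : Ω → PointConfig S} (hA : ∀ ω, A ω = (Xb ω).withMark c)
    (hB : ∀ ω, B ω = (Xb ω).withMark d) {h : (Fin n → S) → PointConfig S → ℝ≥0∞}
    (hh : Measurable (Function.uncurry h)) :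
    ∫⁻ ω, ∑' u : (A ω).distinctTuples n, h u ((B ω).remove (range u.1)) ∂P =
      ∫⁻ ω, ∑' u : (X ω).distinctTuples n, (∏ i, markProb p c (u.1 i)) *
        ∫⁻ z, h u (z.withMark d) ∂markKernel p hp ((X ω).remove (range u.1)) ∂P := by
  obtain rfl : A = fun ω => (Xb ω).withMark c := funext hA
  obtain rfl : B = fun ω => (Xb ω).withMark d := funext hB
  have hF : Measurable fun y : PointConfig (S × Fin 2) =>
      ∑' u : (y.withMark c).distinctTuples n, h u ((y.withMark d).remove (range u.1)) := by
    refine measurable_tsum_distinctTuples (measurable_withMark c)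
      (f := fun u y => h u ((y.withMark d).remove (range u))) ?_
    refine hh.comp (measurable_fst.prodMk (measurable_remove_range.comp
      (measurable_fst.prodMk ((measurable_withMark d).comp measurable_snd))))
  rw [hZ.lintegral_prodMk hp (G := fun q => ∑' u : (q.2.withMark c).distinctTuples n,
    h u ((q.2.withMark d).remove (range u.1))) (hF.comp measurable_snd)]
  refine lintegral_congr fun ω => ?_
  rw [lintegral_markKernel _ hF]
  exact lintegral_tsum_withMark_mark _ c d fun u => hh.of_uncurry_left

/-- Both sides equal the expected sum over tuples of `X` in which the marks of the tuple contribute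
the factor `∏ p(xᵢ) (1 - p(xᵢ))`, symmetric in the two marks. -/
lemma lintegral_tsum_thinned_removed (hZ : IsIndepThinning P p X Xb Z) (hp : Measurable p)
    (hY : ∀ ω, Y ω = X ω \ Z ω) {n : ℕ} {h : (Fin n → S) → PointConfig S → ℝ≥0∞}
    (hh : Measurable (Function.uncurry h)) :
    ∫⁻ ω, ∑' x : (Z ω).distinctTuples n,
          h x (Y ω) * ∏ i, ENNReal.ofReal (1 - p (x.1 i)) ∂P =
        ∫⁻ ω, ∑' x : (Y ω).distinctTuples n,
          h x ((Y ω).remove (range x.1)) * ∏ i, ENNReal.ofReal (p (x.1 i)) ∂P := by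
  have hY' := hZ.removed_eq_withMark hY
  have hprod (c : Fin 2) : Measurable fun q : (Fin n → S) × PointConfig S =>
      ∏ i, markProb p c (q.1 i) :=
    Finset.measurable_prod _ fun i _ => (measurable_markProb hp c).comp (by fun_prop)
  have h1 := hZ.lintegral_tsum_withMark hp hZ.retained hY'
    (h := fun u y => h u y * ∏ i, markProb p 0 (u i)) (hh.mul (hprod 0))
  have h2 := hZ.lintegral_tsum_withMark hp hY' hY'
    (h := fun u y => h u y * ∏ i, markProb p 1 (u i)) (hh.mul (hprod 1))
  have hrem (ω : Ω) (u : (Z ω).distinctTuples n) : (Y ω).remove (range u.1) = Y ω := by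
    rw [hY, sdiff_remove_range]
  simp only [hrem] at h1
  simp only [← markProb_one, ← markProb_zero]
  rw [h1, h2]
  refine lintegral_congr fun ω => tsum_congr fun u => ?_
  have hm : Measurable fun z : PointConfig (S × Fin 2) => h u (z.withMark 0) :=
    hh.of_uncurry_left.comp (measurable_withMark 0)
  rw [lintegral_mul_const _ hm, lintegral_mul_const _ hm]
  ring

/-- The sums over tuples of `Z` and the rest of `Z`, in terms of an intensity of `X`. The
expectation over the marks of the rest of `X` is a function of the rest of `X`, so that the
Georgii-Nguyen-Zessin formula applies to it. -/
lemma lintegral_tsum_thinned (hZ : IsIndepThinning P p X Xb Z) (hp : Measurable p)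
    {μ : Measure S} [SigmaFinite μ] {n : ℕ} {lam : (Fin n → S) → PointConfig S → ℝ≥0∞}
    (hlam : IsPapangelou P μ X n lam) {h : (Fin n → S) → PointConfig S → ℝ≥0∞}
    (hh : Measurable (Function.uncurry h)) :
    ∫⁻ ω, ∑' x : (Z ω).distinctTuples n, h x ((Z ω).remove (range x.1)) ∂P =
      ∫⁻ u, ∫⁻ ω, (∏ i, ENNReal.ofReal (p (u i))) * (h u (Z ω) * lam u (X ω)) ∂P
        ∂(Measure.pi fun _ : Fin n => μ) := by
  have h1 := hZ.lintegral_tsum_withMark hp hZ.retained hZ.retained hh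
  rw [h1, hlam.2 fun u x => (∏ i, markProb p 1 (u i)) *
    ∫⁻ z, h u (z.withMark 1) ∂markKernel p hp x]
  · refine lintegral_congr fun u => ?_
    have hlu : Measurable (lam u) := hlam.1.of_uncurry_left
    have hhu : Measurable (h u) := hh.of_uncurry_left
    have h2 := hZ.lintegral_prodMk hp (G := fun q =>
      (∏ i, ENNReal.ofReal (p (u i))) * (h u (q.2.withMark 1) * lam u q.1))
      (((hhu.comp ((measurable_withMark 1).comp measurable_snd)).mul
        (hlu.comp measurable_fst)).const_mul _)
    simp only [← hZ.retained] at h2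
    rw [h2]
    refine lintegral_congr fun ω => ?_
    have hm : Measurable fun z : PointConfig (S × Fin 2) => h u (z.withMark 1) :=
      hhu.comp (measurable_withMark 1)
    rw [lintegral_const_mul _ (hm.mul_const _), lintegral_mul_const _ hm]
    simp only [markProb_one, mul_assoc]
  · refine Measurable.mul (Finset.measurable_prod _ fun i _ =>
      (measurable_markProb hp 1).comp (by fun_prop)) ?_
    exact Measurable.lintegral_kernel_prod_right
      (κ := (markKernel p hp).comap (Prod.snd : (Fin n → S) × PointConfig S → _) measurable_snd)
      (f := fun q z => h q.1 (z.withMark 1))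
      (hh.comp ((measurable_fst.comp measurable_fst).prodMk
        ((measurable_withMark 1).comp measurable_snd)))

end IsIndepThinning

/-! ### Intensities of the thinned process -/

namespace IsIndepThinning

open PointConfig

variable {S Ω : Type*} [MetricSpace S] [SecondCountableTopology S] [MeasurableSpace S]
  [BorelSpace S] [MeasurableSpace Ω] {P : Measure Ω} [IsProbabilityMeasure P] {p : S → I}
  {X Z Y : Ω → PointConfig S} {Xb : Ω → PointConfig (S × Fin 2)}

/-- The identity for real functions follows from the one for their positive and negative parts. -/
lemma integral_tsum_thinned_removed (hZ : IsIndepThinning P p X Xb Z) (hp : Measurable p)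
    (hY : ∀ ω, Y ω = X ω \ Z ω) {n : ℕ} {h : (Fin n → S) → PointConfig S → ℝ}
    (hh : Measurable (Function.uncurry h))
    (hfin : ∫⁻ ω, ∑' x : (Z ω).distinctTuples n,
          ‖h x (Y ω) * ∏ i, (1 - (p (x.1 i) : ℝ))‖ₑ ∂P ≠ ⊤ ∨
        ∫⁻ ω, ∑' x : (Y ω).distinctTuples n,
          ‖h x ((Y ω).remove (range x.1)) * ∏ i, (p (x.1 i) : ℝ)‖ₑ ∂P ≠ ⊤) :
    (∀ᵐ ω ∂P, Summable fun x : (Z ω).distinctTuples n =>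
        h x (Y ω) * ∏ i, (1 - (p (x.1 i) : ℝ))) ∧
    (∀ᵐ ω ∂P, Summable fun x : (Y ω).distinctTuples n =>
        h x ((Y ω).remove (range x.1)) * ∏ i, (p (x.1 i) : ℝ)) ∧
    Integrable (fun ω => ∑' x : (Z ω).distinctTuples n,
        h x (Y ω) * ∏ i, (1 - (p (x.1 i) : ℝ))) P ∧
    Integrable (fun ω => ∑' x : (Y ω).distinctTuples n,
        h x ((Y ω).remove (range x.1)) * ∏ i, (p (x.1 i) : ℝ)) P ∧
    ∫ ω, ∑' x : (Z ω).distinctTuples n,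
        h x (Y ω) * ∏ i, (1 - (p (x.1 i) : ℝ)) ∂P =
      ∫ ω, ∑' x : (Y ω).distinctTuples n,
        h x ((Y ω).remove (range x.1)) * ∏ i, (p (x.1 i) : ℝ) ∂P := by
  have hq0 (u : Fin n → S) (i : Fin n) : 0 ≤ 1 - (p (u i) : ℝ) := sub_nonneg.2 (p (u i)).2.2
  have hp0 (u : Fin n → S) (i : Fin n) : 0 ≤ (p (u i) : ℝ) := (p (u i)).2.1
  have ofReal_q (r : ℝ) (u : Fin n → S) : ENNReal.ofReal (r * ∏ i, (1 - (p (u i) : ℝ))) =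
      ENNReal.ofReal r * ∏ i, ENNReal.ofReal (1 - p (u i)) := by
    rw [ENNReal.ofReal_mul' (Finset.prod_nonneg fun i _ => hq0 u i),
      ENNReal.ofReal_prod_of_nonneg fun i _ => hq0 u i]
  have ofReal_p (r : ℝ) (u : Fin n → S) : ENNReal.ofReal (r * ∏ i, (p (u i) : ℝ)) =
      ENNReal.ofReal r * ∏ i, ENNReal.ofReal (p (u i)) := by
    rw [ENNReal.ofReal_mul' (Finset.prod_nonneg fun i _ => hp0 u i),
      ENNReal.ofReal_prod_of_nonneg fun i _ => hp0 u i]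
  have enorm_q (r : ℝ) (u : Fin n → S) : ‖r * ∏ i, (1 - (p (u i) : ℝ))‖ₑ =
      ‖r‖ₑ * ∏ i, ENNReal.ofReal (1 - p (u i)) := by
    rw [enorm_mul, Real.enorm_of_nonneg (Finset.prod_nonneg fun i _ => hq0 u i),
      ENNReal.ofReal_prod_of_nonneg fun i _ => hq0 u i]
  have enorm_p (r : ℝ) (u : Fin n → S) : ‖r * ∏ i, (p (u i) : ℝ)‖ₑ =
      ‖r‖ₑ * ∏ i, ENNReal.ofReal (p (u i)) := by
    rw [enorm_mul, Real.enorm_of_nonneg (Finset.prod_nonneg fun i _ => hp0 u i),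
      ENNReal.ofReal_prod_of_nonneg fun i _ => hp0 u i]
  -- The absolute sums have the same expectation, so both are finite as soon as one is.
  have habs := hZ.lintegral_tsum_thinned_removed hp hY (h := fun u y => ‖h u y‖ₑ) hh.enorm
  have hpos := hZ.lintegral_tsum_thinned_removed hp hY (h := fun u y => ENNReal.ofReal (h u y))
    hh.ennreal_ofReal
  have hneg := hZ.lintegral_tsum_thinned_removed hp hY (h := fun u y => ENNReal.ofReal (-h u y))
    hh.neg.ennreal_ofReal
  simp only [← enorm_q, ← enorm_p] at habs
  have hfin1 : ∫⁻ ω, ∑' x : (Z ω).distinctTuples n,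
      ‖h x (Y ω) * ∏ i, (1 - (p (x.1 i) : ℝ))‖ₑ ∂P ≠ ⊤ := hfin.elim id fun h => habs ▸ h
  have hfin2 := habs ▸ hfin1
  simp only [← ofReal_q, ← ofReal_p] at hpos hneg
  have hZm := hZ.measurable_thinned
  have hYm := hZ.measurable_removed hY
  -- Applied with `c` the identity and the negation, for the positive and the negative parts.
  have hmp (c : ℝ → ℝ) (hc : Measurable c) : Measurable fun q : (Fin n → S) × PointConfig S =>
      ENNReal.ofReal (c (h q.1 q.2 * ∏ i, (p (q.1 i) : ℝ))) := by
    have : Measurable fun q : (Fin n → S) × PointConfig S => h q.1 q.2 := hh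
    fun_prop
  have hmq (c : ℝ → ℝ) (hc : Measurable c) : Measurable fun q : (Fin n → S) × PointConfig S =>
      ENNReal.ofReal (c (h q.1 q.2 * ∏ i, (1 - (p (q.1 i) : ℝ)))) := by
    have : Measurable fun q : (Fin n → S) × PointConfig S => h q.1 q.2 := hh
    fun_prop
  have hm1 (c : ℝ → ℝ) (hc : Measurable c) : Measurable fun ω => ∑' x : (Z ω).distinctTuples n,
      ENNReal.ofReal (c (h x (Y ω) * ∏ i, (1 - (p (x.1 i) : ℝ)))) :=
    (measurable_tsum_distinctTuples (c := fun q : PointConfig S × PointConfig S => q.1)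
      measurable_fst (f := fun u q => ENNReal.ofReal (c (h u q.2 * ∏ i, (1 - (p (u i) : ℝ)))))
      ((hmq c hc).comp (measurable_fst.prodMk (measurable_snd.comp measurable_snd)))).comp
      (hZm.prodMk hYm)
  have hm2 (c : ℝ → ℝ) (hc : Measurable c) : Measurable fun ω => ∑' x : (Y ω).distinctTuples n,
      ENNReal.ofReal (c (h x ((Y ω).remove (range x.1)) * ∏ i, (p (x.1 i) : ℝ))) :=
    (measurable_tsum_distinctTuples (c := fun y : PointConfig S => y)
      measurable_id (f := fun u y => ENNReal.ofReal
        (c (h u (y.remove (range u)) * ∏ i, (p (u i) : ℝ))))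
      ((hmp c hc).comp (measurable_fst.prodMk measurable_remove_range))).comp hYm
  obtain ⟨hs1, hi1, he1⟩ := summable_and_integrable_tsum
    (fun ω (x : (Z ω).distinctTuples n) => h x (Y ω) * ∏ i, (1 - (p (x.1 i) : ℝ)))
    (hm1 _ measurable_id) (hm1 _ measurable_neg) hfin1
  obtain ⟨hs2, hi2, he2⟩ := summable_and_integrable_tsum
    (fun ω (x : (Y ω).distinctTuples n) =>
      h x ((Y ω).remove (range x.1)) * ∏ i, (p (x.1 i) : ℝ))
    (hm2 _ measurable_id) (hm2 _ measurable_neg) hfin2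
  refine ⟨hs1, hs2, hi1, hi2, ?_⟩
  rw [he1, he2, hpos]
  simp only [← neg_mul]
  rw [hneg]

/-- Both intensities integrate functions `h(u, Z)`: the Campbell formula and the
Georgii-Nguyen-Zessin formula of `X` turn the sum over tuples of `Z` into an integral of
`∏ p(uᵢ) E[h(u, Z) lamX(u; X)]`. -/
lemma papangelou_thinned (hZ : IsIndepThinning P p X Xb Z) (hp : Measurable p)
    (hp0 : ∀ u, (p u : ℝ) ∈ Ioo (0 : ℝ) 1) {μ : Measure S} [SigmaFinite μ] {n : ℕ}
    {lamX lamZ : (Fin n → S) → PointConfig S → ℝ≥0∞}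
    (hX : IsPapangelou P μ X n lamX) (hlZ : IsPapangelou P μ Z n lamZ) :
    ∀ᵐ u ∂(Measure.pi fun _ : Fin n => μ), (fun ω => lamZ u (Z ω)) =ᵐ[P] fun ω =>
      (∏ i, ENNReal.ofReal (p (u i))) *
        condLExp (MeasurableSpace.comap Z inferInstance) P (fun ω' => lamX u (X ω')) ω := by
  have hπ0 (u : Fin n → S) : ∏ i, ENNReal.ofReal (p (u i)) ≠ 0 :=
    Finset.prod_ne_zero_iff.2 fun i _ => (ENNReal.ofReal_pos.2 (hp0 _).1).ne'
  have hπt (u : Fin n → S) : ∏ i, ENNReal.ofReal (p (u i)) ≠ ⊤ :=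
    ENNReal.prod_ne_top fun i _ => ENNReal.ofReal_ne_top
  have hπm : Measurable fun u : Fin n → S => ∏ i, ENNReal.ofReal (p (u i)) := by fun_prop
  -- The factor `∏ p(uᵢ)` is positive and finite, so its inverse may enter the test function.
  have key := ae_condLExp_eq_of_lintegral_eq (P := P) (ν := Measure.pi fun _ : Fin n => μ)
    hZ.measurable_thinned (f := fun u ω => lamX u (X ω))
    (hX.1.comp (measurable_fst.prodMk (hZ.measurable_ground.comp measurable_snd)))
    (g := fun u z => (∏ i, ENNReal.ofReal (p (u i)))⁻¹ * lamZ u z)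
    ((hπm.comp measurable_fst).inv.mul hlZ.1) fun D hD => by
      have hm : Measurable fun q : (Fin n → S) × PointConfig S =>
          (∏ i, ENNReal.ofReal (p (q.1 i)))⁻¹ * D.indicator 1 q :=
        (hπm.comp measurable_fst).inv.mul (measurable_one.indicator hD)
      have h1 := hZ.lintegral_tsum_thinned hp hX (h := fun u z =>
        (∏ i, ENNReal.ofReal (p (u i)))⁻¹ * D.indicator 1 (u, z)) hm
      rw [hlZ.2 (fun u z => (∏ i, ENNReal.ofReal (p (u i)))⁻¹ * D.indicator 1 (u, z)) hm] at h1
      refine Eq.trans ?_ (h1.symm.trans ?_)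
      · refine lintegral_congr fun u => lintegral_congr fun ω => ?_
        rw [← mul_assoc, ← mul_assoc, ENNReal.mul_inv_cancel (hπ0 u) (hπt u), one_mul]
      · refine lintegral_congr fun u => lintegral_congr fun ω => ?_
        ring
  filter_upwards [key] with u hu
  filter_upwards [hu] with ω hω
  rw [hω, ← mul_assoc, ENNReal.mul_inv_cancel (hπ0 u) (hπt u), one_mul]

lemma productDensity_thinned (hZ : IsIndepThinning P p X Xb Z) (hp : Measurable p)
    {μ : Measure S} [SigmaFinite μ] {n : ℕ} {rhoX rhoZ : (Fin n → S) → ℝ≥0∞}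
    (hX : IsProductDensity P μ X n rhoX) (hrZ : IsProductDensity P μ Z n rhoZ) :
    rhoZ =ᵐ[Measure.pi fun _ : Fin n => μ] fun u =>
      (∏ i, ENNReal.ofReal (p (u i))) * rhoX u := by
  have hπm : Measurable fun u : Fin n → S => ∏ i, ENNReal.ofReal (p (u i)) := by fun_prop
  refine ae_eq_of_forall_setLIntegral_eq_of_sigmaFinite hrZ.1 (hπm.mul hX.1) fun D hD _ => ?_
  have hm : Measurable (D.indicator (1 : (Fin n → S) → ℝ≥0∞)) := measurable_one.indicator hD
  have h1 := hZ.lintegral_tsum_withMark hp hZ.retained hZ.retained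
    (h := fun u _ => D.indicator 1 u) (hm.comp measurable_fst)
  rw [hrZ.2 _ hm] at h1
  simp only [lintegral_const, measure_univ, mul_one, markProb_one] at h1
  rw [hX.2 (fun u => (∏ i, ENNReal.ofReal (p (u i))) * D.indicator 1 u) (hπm.mul hm)] at h1
  rw [← lintegral_indicator hD, ← lintegral_indicator hD]
  convert! h1 using 2
  · ext u
    by_cases hu : u ∈ D <;> simp [hu]
  · ext u
    by_cases hu : u ∈ D <;> simp [hu]

/-- The sum over tuples of `Z` of a function of `Y` is computed from the marked process on one hand,
and from `Y`, by exchanging the roles of retained and removed points, on the other hand. -/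
lemma papangelou_marked (hZ : IsIndepThinning P p X Xb Z) (hp : Measurable p)
    (hp0 : ∀ u, (p u : ℝ) ∈ Ioo (0 : ℝ) 1) (hY : ∀ ω, Y ω = X ω \ Z ω)
    {μ : Measure S} [SigmaFinite μ] {n : ℕ}
    {lamXb : (Fin n → S × Fin 2) → PointConfig (S × Fin 2) → ℝ≥0∞}
    {lamY : (Fin n → S) → PointConfig S → ℝ≥0∞}
    (hXb : IsPapangelou P (μ.prod Measure.count) Xb n lamXb) (hlY : IsPapangelou P μ Y n lamY) :
    ∀ᵐ u ∂(Measure.pi fun _ : Fin n => μ),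
      condLExp (MeasurableSpace.comap Y inferInstance) P
          (fun ω => lamXb (fun i => (u i, 1)) (Xb ω)) =ᵐ[P] fun ω =>
        (∏ i, ENNReal.ofReal (p (u i))) / (∏ i, ENNReal.ofReal (1 - p (u i))) *
          lamY u (Y ω) := by
  have hq0 (u : Fin n → S) : ∏ i, ENNReal.ofReal (1 - p (u i)) ≠ 0 :=
    Finset.prod_ne_zero_iff.2 fun i _ => (ENNReal.ofReal_pos.2 (sub_pos.2 (hp0 _).2)).ne'
  have hqt (u : Fin n → S) : ∏ i, ENNReal.ofReal (1 - p (u i)) ≠ ⊤ :=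
    ENNReal.prod_ne_top fun i _ => ENNReal.ofReal_ne_top
  have hπm : Measurable fun u : Fin n → S => ∏ i, ENNReal.ofReal (p (u i)) := by fun_prop
  have hqm : Measurable fun u : Fin n → S => ∏ i, ENNReal.ofReal (1 - p (u i)) := by fun_prop
  have hem : Measurable fun u : Fin n → S => fun i => (u i, (1 : Fin 2)) := by fun_prop
  refine ae_condLExp_eq_of_lintegral_eq (hZ.measurable_removed hY)
    (f := fun (u : Fin n → S) ω => lamXb (fun i => (u i, 1)) (Xb ω))
    (hXb.1.comp ((hem.comp measurable_fst).prodMk (hZ.measurable_marked.comp measurable_snd)))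
    (g := fun u y => (∏ i, ENNReal.ofReal (p (u i))) / (∏ i, ENNReal.ofReal (1 - p (u i))) *
      lamY u y)
    (((hπm.comp measurable_fst).div (hqm.comp measurable_fst)).mul hlY.1) fun D hD => ?_
  have hDm : Measurable (D.indicator (1 : (Fin n → S) × PointConfig S → ℝ≥0∞)) :=
    measurable_one.indicator hD
  -- The Georgii-Nguyen-Zessin formula of the marked process is tested on tuples with all marks `1`
  -- and a function of the points with mark `0`, which is a sum over tuples of `Z`.
  have h1 := hXb.2 (fun w y => {w : Fin n → S × Fin 2 | ∀ i, (w i).2 = 1}.indicator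
    (fun w => D.indicator 1 ((fun i => (w i).1), y.withMark 0)) w) (by
      refine Measurable.indicator (f := fun q : (Fin n → S × Fin 2) × PointConfig (S × Fin 2) =>
        D.indicator (1 : (Fin n → S) × PointConfig S → ℝ≥0∞)
          ((fun i => (q.1 i).1), q.2.withMark 0)) ?_
        (measurable_fst (measurableSet_forall_mark_one n))
      refine hDm.comp (Measurable.prodMk (by fun_prop)
        ((measurable_withMark 0).comp measurable_snd)))
  replace h1 := (lintegral_congr fun ω => (tsum_distinctTuples_indicator_mark_one (Xb ω)
    (n := n) fun u x => D.indicator 1 (u, x)).symm).trans h1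
  have h2 := lintegral_indicator_mark_one_pi μ (n := n)
    (φ := fun w => ∫⁻ ω, D.indicator 1 ((fun i => (w i).1), (Xb ω).withMark 0) *
      lamXb w (Xb ω) ∂P) (by
      refine Measurable.lintegral_prod_right' (f := fun q : (Fin n → S × Fin 2) × Ω =>
        D.indicator 1 ((fun i => (q.1 i).1), (Xb q.2).withMark 0) * lamXb q.1 (Xb q.2)) ?_
      refine (hDm.comp (Measurable.prodMk (by fun_prop) ((measurable_withMark 0).comp
        (hZ.measurable_marked.comp measurable_snd)))).mul
        (hXb.1.comp (measurable_fst.prodMk (hZ.measurable_marked.comp measurable_snd))))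
  have h3 (w : Fin n → S × Fin 2) : ∫⁻ ω, {w : Fin n → S × Fin 2 | ∀ i, (w i).2 = 1}.indicator
      (fun w => D.indicator 1 ((fun i => (w i).1), (Xb ω).withMark 0)) w * lamXb w (Xb ω) ∂P =
      {w : Fin n → S × Fin 2 | ∀ i, (w i).2 = 1}.indicator (fun w =>
        ∫⁻ ω, D.indicator 1 ((fun i => (w i).1), (Xb ω).withMark 0) * lamXb w (Xb ω) ∂P) w := by
    by_cases hw : w ∈ {w : Fin n → S × Fin 2 | ∀ i, (w i).2 = 1}
    · simp only [indicator_of_mem hw]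
    · simp only [indicator_of_notMem hw, zero_mul, lintegral_zero]
  rw [lintegral_congr h3, h2] at h1
  have h4 := hZ.lintegral_tsum_thinned_removed hp hY (n := n)
    (h := fun u y => (∏ i, ENNReal.ofReal (1 - p (u i)))⁻¹ * D.indicator 1 (u, y))
    ((hqm.comp measurable_fst).inv.mul hDm)
  have h5 := hlY.2 (fun u y => (∏ i, ENNReal.ofReal (1 - p (u i)))⁻¹ * D.indicator 1 (u, y) *
    ∏ i, ENNReal.ofReal (p (u i)))
    (((hqm.comp measurable_fst).inv.mul hDm).mul (hπm.comp measurable_fst))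
  have h6 (ω : Ω) : ∑' x : (Z ω).distinctTuples n,
      (∏ i, ENNReal.ofReal (1 - p (x.1 i)))⁻¹ * D.indicator 1 (x.1, Y ω) *
        ∏ i, ENNReal.ofReal (1 - p (x.1 i)) =
      ∑' x : ((Xb ω).withMark 1).distinctTuples n, D.indicator 1 (x.1, (Xb ω).withMark 0) := by
    rw [← hZ.removed_eq_withMark hY, ← hZ.retained]
    refine tsum_congr fun x => ?_
    rw [mul_right_comm, ENNReal.inv_mul_cancel (hq0 _) (hqt _), one_mul]
  rw [lintegral_congr h6, h1, h5] at h4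
  simp only [hZ.removed_eq_withMark hY] at h4 ⊢
  rw [h4]
  refine lintegral_congr fun u => lintegral_congr fun ω => ?_
  rw [div_eq_mul_inv]
  ring

end IsIndepThinning

theorem mainTheorem2 {S : Type*} [MetricSpace S] [CompleteSpace S] [SecondCountableTopology S]
    [MeasurableSpace S] [BorelSpace S] (μ : Measure S) [SigmaFinite μ]
    {Ω : Type*} [MeasurableSpace Ω] (P : Measure Ω) [IsProbabilityMeasure P]
    (p : S → I) (hp_meas : Measurable p) (hp : ∀ u, (p u : ℝ) ∈ Ioo (0 : ℝ) 1)
    (X : Ω → PointConfig S) (Xb : Ω → PointConfig (S × Fin 2)) (Z Y : Ω → PointConfig S)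
    (hZ : IsIndepThinning P p X Xb Z) (hY : ∀ ω, Y ω = X ω \ Z ω)
    (n : ℕ) (hn : 1 ≤ n) :
    -- the thinning formula, for non-negative `h`
    (∀ h : (Fin n → S) → PointConfig S → ℝ≥0∞, Measurable (Function.uncurry h) →
      ∫⁻ ω, ∑' x : (Z ω).distinctTuples n,
          h x (Y ω) * ∏ i, ENNReal.ofReal (1 - p (x.1 i)) ∂P =
        ∫⁻ ω, ∑' x : (Y ω).distinctTuples n,
          h x ((Y ω).remove (range x.1)) * ∏ i, ENNReal.ofReal (p (x.1 i)) ∂P) ∧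
    -- the thinning formula, for integrable real `h`
    (∀ h : (Fin n → S) → PointConfig S → ℝ, Measurable (Function.uncurry h) →
      (∫⁻ ω, ∑' x : (Z ω).distinctTuples n,
          ‖h x (Y ω) * ∏ i, (1 - (p (x.1 i) : ℝ))‖ₑ ∂P ≠ ⊤ ∨
        ∫⁻ ω, ∑' x : (Y ω).distinctTuples n,
          ‖h x ((Y ω).remove (range x.1)) * ∏ i, (p (x.1 i) : ℝ)‖ₑ ∂P ≠ ⊤) →
      (∀ᵐ ω ∂P, Summable fun x : (Z ω).distinctTuples n =>
          h x (Y ω) * ∏ i, (1 - (p (x.1 i) : ℝ))) ∧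
      (∀ᵐ ω ∂P, Summable fun x : (Y ω).distinctTuples n =>
          h x ((Y ω).remove (range x.1)) * ∏ i, (p (x.1 i) : ℝ)) ∧
      Integrable (fun ω => ∑' x : (Z ω).distinctTuples n,
          h x (Y ω) * ∏ i, (1 - (p (x.1 i) : ℝ))) P ∧
      Integrable (fun ω => ∑' x : (Y ω).distinctTuples n,
          h x ((Y ω).remove (range x.1)) * ∏ i, (p (x.1 i) : ℝ)) P ∧
      ∫ ω, ∑' x : (Z ω).distinctTuples n,
          h x (Y ω) * ∏ i, (1 - (p (x.1 i) : ℝ)) ∂P =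
        ∫ ω, ∑' x : (Y ω).distinctTuples n,
          h x ((Y ω).remove (range x.1)) * ∏ i, (p (x.1 i) : ℝ) ∂P) ∧
    -- the Papangelou conditional intensity of `Z`
    (∀ lamX lamZ : (Fin n → S) → PointConfig S → ℝ≥0∞,
      IsPapangelou P μ X n lamX → IsPapangelou P μ Z n lamZ →
      ∀ᵐ u ∂(Measure.pi fun _ : Fin n => μ),
        (fun ω => lamZ u (Z ω)) =ᵐ[P] fun ω =>
          (∏ i, ENNReal.ofReal (p (u i))) *
            condLExp (MeasurableSpace.comap Z inferInstance) P (fun ω' => lamX u (X ω')) ω) ∧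
    -- the product density of `Z`
    (∀ rhoX rhoZ : (Fin n → S) → ℝ≥0∞,
      IsProductDensity P μ X n rhoX → IsProductDensity P μ Z n rhoZ →
      rhoZ =ᵐ[Measure.pi fun _ : Fin n => μ] fun u =>
        (∏ i, ENNReal.ofReal (p (u i))) * rhoX u) ∧
    -- the Papangelou conditional intensity of the marked process, given `Y`
    (∀ (lamXb : (Fin n → S × Fin 2) → PointConfig (S × Fin 2) → ℝ≥0∞)
      (lamY : (Fin n → S) → PointConfig S → ℝ≥0∞),
      IsPapangelou P (μ.prod Measure.count) Xb n lamXb → IsPapangelou P μ Y n lamY →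
      ∀ᵐ u ∂(Measure.pi fun _ : Fin n => μ),
        condLExp (MeasurableSpace.comap Y inferInstance) P
            (fun ω => lamXb (fun i => (u i, 1)) (Xb ω)) =ᵐ[P] fun ω =>
          (∏ i, ENNReal.ofReal (p (u i))) / (∏ i, ENNReal.ofReal (1 - p (u i))) *
            lamY u (Y ω)) := by
  exact ⟨fun _ hh => hZ.lintegral_tsum_thinned_removed hp_meas hY hh,
    fun _ hh hfin => hZ.integral_tsum_thinned_removed hp_meas hY hh hfin,
    fun _ _ hX hlZ => hZ.papangelou_thinned hp_meas hp hX hlZ,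
    fun _ _ hX hrZ => hZ.productDensity_thinned hp_meas hX hrZ,
    fun _ _ hXb hlY => hZ.papangelou_marked hp_meas hp hY hXb hlY⟩
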